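/- For a Dynkin diagram $D$ (of a finite-dimensional complex semisimple Lie algebra) and a connected nonempty subdiagram $I\subseteq D$, let $w_0^I$ be the longest element of the parabolic subgroup $W^I$ of the Weyl group, generated by the simple reflections $r_i$, $i\in I$, and let $\theta_I$ be the Dynkin diagram automorphism of $I$ with $\alpha_{\theta_I(i)}=-w_0^I\alpha_i$ for $i\in I$. The cactus group $J_D$ has generators $s_I$, one for each connected subdiagram $I$ of $D$, and relations (1) $s_I^2=1$; (2) $s_Is_J=s_Js_I$ if $I\cup J$ is disconnected; (3) $s_Is_J=s_{\theta_I(J)}s_I$ if $J\subseteq I$. Let $X\hookrightarrow Y$ be one of the following foldings, given by an automorphism $\mathrm{aut}$ of the diagram $Y$ and a bijection $\sigma\colon X\to Y/\mathrm{aut}$ under which $X$ is the folded diagram (nodes are numbered as by Bourbaki): * $X=C_n$, $Y=A_{2n-1}$ ($n\ge 2$), $\mathrm{aut}(i)=2n-i$, $\sigma(i)=\{i,2n-i\}$; * $X=B_n$, $Y=D_{n+1}$ ($n\ge 2$, where $D_3=A_3$ with node $1$ joined to nodes $2$ and $3$), $\mathrm{aut}$ exchanges $n$ and $n+1$, $\sigma(i)=\{i\}$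 for $i<n$ and $\sigma(n)=\{n,n+1\}$; * $X=G_2$, $Y=D_4$, $\mathrm{aut}$ rotates the nodes $1,3,4$, $\sigma(1)=\{1,3,4\}$ and $\sigma(2)=\{2\}$; * $X=F_4$, $Y=E_6$, $\mathrm{aut}$ is the nontrivial automorphism of $E_6$, $\sigma(1)=\{2\}$, $\sigma(2)=\{4\}$, $\sigma(3)=\{3,5\}$, $\sigma(4)=\{1,6\}$. For $I\subseteq X$ write $\sigma(I)\subseteq Y$ for the union of the orbits $\sigma(i)$, $i\in I$, and for $I$ connected put $$\tilde s_I=\prod_{\tilde I}s^Y_{\tilde I}\in J_Y,$$ the product over the connected components $\tilde I$ of $\sigma(I)$ of the (pairwise commuting) generators of $J_Y$. The virtual cactus group $J^v_X$ has generators $s_{\sigma(I)}$, one for each set $\sigma(I)$ with $I\subseteq X$ a connected subdiagram, and relations $s_{\sigma(I)}^2=1$; $s_{\sigma(I)}s_{\sigma(J)}=s_{\sigma(J)}s_{\sigma(I)}$ if $I\cup J$ is disconnected; $s_{\sigma(I)}s_{\sigma(J)}=s_{\sigma(\theta_I(J))}s_{\sigma(I)}$ if $J\subseteq I$. Then there is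 a group homomorphism $\Phi\colon J_X\to J_Y$ with $\Phi(s_I)=\tilde s_I$ for every connected subdiagram $I$ of $X$, and it is injective. Moreover there are group isomorphisms $J^v_X\cong\Phi(J_X)$, $s_{\sigma(I)}\mapsto\tilde s_I$, and $J^v_X\cong J_X$, $s_{\sigma(I)}\mapsto s_I$. -/

import Mathlib

/-!
Cartan matrices follow Mathlib's (Bourbaki's) convention `A i j = ⟨αᵢ, αⱼ^∨⟩`.  A Dynkin diagram
is given by its Cartan matrix; its nodes are the indices.
-/

noncomputable section

namespace Dynkin

variable {ι : Type*}

/-- The graph underlying the Dynkin diagram: distinct nodes `i`, `j` are joined iff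
`A i j ≠ 0` or `A j i ≠ 0`. -/
def graph (A : Matrix ι ι ℤ) : SimpleGraph ι :=
  SimpleGraph.fromRel fun i j => A i j ≠ 0

/-- `S` spans a connected (in particular nonempty) subdiagram. -/
def IsConn (A : Matrix ι ι ℤ) (S : Set ι) : Prop :=
  ((graph A).induce S).Connected

/-- The connected subdiagrams, ordered by inclusion of their sets of nodes. -/
abbrev ConnSub (A : Matrix ι ι ℤ) : Type _ :=
  {S : Set ι // IsConn A S}

section Weyl

variable [Fintype ι] [DecidableEq ι]

/-- The simple root `αᵢ`, as a vector of the root lattice `⨁ ℤ αⱼ`. -/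
def simpleRoot (i : ι) : ι → ℤ := Pi.single i 1

/-- The simple coroot `αᵢ^∨` as a functional on the root lattice: `αⱼ ↦ A j i`. -/
def simpleCoroot (A : Matrix ι ι ℤ) (i : ι) : (ι → ℤ) →ₗ[ℤ] ℤ :=
  LinearMap.proj i ∘ₗ A.vecMulLinear

/-- The simple reflection `v ↦ v - ⟨v, αᵢ^∨⟩ αᵢ`. -/
def simpleReflection (A : Matrix ι ι ℤ) (i : ι) : Module.End ℤ (ι → ℤ) :=
  LinearMap.id - (simpleCoroot A i).smulRight (simpleRoot i)

theorem simpleCoroot_simpleRoot (A : Matrix ι ι ℤ) (i j : ι) :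
    simpleCoroot A i (simpleRoot j) = A j i := by
  simp [simpleCoroot, simpleRoot]

theorem simpleReflection_simpleRoot (A : Matrix ι ι ℤ) (i j : ι) :
    simpleReflection A i (simpleRoot j) = simpleRoot j - A j i • simpleRoot i := by
  simp [simpleReflection, simpleCoroot_simpleRoot]

/-- Simple reflections are involutions, so that a monoid generated by some of them is a group. -/
theorem simpleReflection_mul_self (A : Matrix ι ι ℤ) (i : ι) (h : A i i = 2) :
    simpleReflection A i * simpleReflection A i = 1 := by
  refine LinearMap.ext fun v => ?_
  simp only [simpleReflection, Module.End.mul_apply, Module.End.one_apply, LinearMap.sub_apply,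
    LinearMap.id_apply, LinearMap.smulRight_apply, map_sub, map_smul, simpleCoroot_simpleRoot, h]
  ext k
  simp
  ring

/-- The parabolic subgroup `W^I` of the Weyl group, generated by the `rᵢ`, `i ∈ I`. -/
def parabolic (A : Matrix ι ι ℤ) (I : Set ι) : Submonoid (Module.End ℤ (ι → ℤ)) :=
  Submonoid.closure (simpleReflection A '' I)

/-- The length of an element of `W^I`: the least number of factors in an expression of it as a
product of simple reflections `rᵢ`, `i ∈ I`. -/
def weylLength (A : Matrix ι ι ℤ) (I : Set ι) (w : Module.End ℤ (ι → ℤ)) : ℕ :=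
  sInf {n | ∃ l : List ι, (∀ i ∈ l, i ∈ I) ∧ l.length = n ∧ (l.map (simpleReflection A)).prod = w}

/-- `w` is the longest element `w₀^I` of `W^I`. -/
def IsLongest (A : Matrix ι ι ℤ) (I : Set ι) (w : Module.End ℤ (ι → ℤ)) : Prop :=
  w ∈ parabolic A I ∧ ∀ v ∈ parabolic A I, weylLength A I v ≤ weylLength A I w

/-- `θ` is the Dynkin diagram automorphism `θ_I` of the subdiagram `I`, which is determined by
`α_{θ_I(i)} = - w₀^I αᵢ` for `i ∈ I`. -/
structure IsTheta (A : Matrix ι ι ℤ) (I : Set ι) (θ : Equiv.Perm I) : Prop where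
  cartan : ∀ i j : I, A (θ i) (θ j) = A i j
  longest : ∃ w, IsLongest A I w ∧
    ∀ i : I, simpleRoot (θ i : ι) = -w (simpleRoot (i : ι))

/-- `K = θ_I(J)`. -/
def IsThetaImage (A : Matrix ι ι ℤ) (I J K : Set ι) : Prop :=
  ∃ θ : Equiv.Perm I, IsTheta A I θ ∧ K = {k | ∃ i : I, (i : ι) ∈ J ∧ (θ i : ι) = k}

/-- The defining relations of the cactus group. -/
inductive CactusRel (A : Matrix ι ι ℤ) : FreeGroup (ConnSub A) → Prop
  | sq (I : ConnSub A) : CactusRel A (FreeGroup.of I * FreeGroup.of I)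
  | comm (I J : ConnSub A) (h : ¬ IsConn A (I.1 ∪ J.1)) :
      CactusRel A ((FreeGroup.of I * FreeGroup.of J) * (FreeGroup.of J * FreeGroup.of I)⁻¹)
  | conj (I J K : ConnSub A) (h : J.1 ⊆ I.1) (hK : IsThetaImage A I.1 J.1 K.1) :
      CactusRel A ((FreeGroup.of I * FreeGroup.of J) * (FreeGroup.of K * FreeGroup.of I)⁻¹)

/-- The cactus group of a Dynkin diagram. -/
abbrev CactusGroup (A : Matrix ι ι ℤ) : Type _ :=
  PresentedGroup {r | CactusRel A r}

/-- The generator `s_I` of the cactus group. -/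
def gen {A : Matrix ι ι ℤ} (I : ConnSub A) : CactusGroup A :=
  PresentedGroup.of I

theorem gen_comm {A : Matrix ι ι ℤ} (I J : ConnSub A) (h : ¬ IsConn A (I.1 ∪ J.1)) :
    Commute (gen I) (gen J) :=
  mul_inv_eq_one.mp (PresentedGroup.one_of_mem (CactusRel.comm I J h))

end Weyl

section Components

variable [Finite ι]

/-- The connected components of the subdiagram with set of nodes `S`: the maximal connected
subdiagrams contained in `S`. -/
def components (A : Matrix ι ι ℤ) (S : Set ι) : Finset (ConnSub A) :=
  (Set.toFinite {C : ConnSub A | Maximal (fun D : ConnSub A => D.1 ⊆ S) C}).toFinset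

theorem mem_components {A : Matrix ι ι ℤ} {S : Set ι} {C : ConnSub A} :
    C ∈ components A S ↔ Maximal (fun D : ConnSub A => D.1 ⊆ S) C := by
  simp [components]

theorem not_isConn_union {A : Matrix ι ι ℤ} {S : Set ι} {C D : ConnSub A}
    (hC : C ∈ components A S) (hD : D ∈ components A S) (hne : C ≠ D) :
    ¬ IsConn A (C.1 ∪ D.1) := by
  intro h
  rw [mem_components] at hC hD
  have hS : (⟨C.1 ∪ D.1, h⟩ : ConnSub A).1 ⊆ S := Set.union_subset hC.1 hD.1
  have h1 : C.1 ∪ D.1 ⊆ C.1 := hC.2 (y := ⟨C.1 ∪ D.1, h⟩) hS (Set.subset_union_left (t := D.1))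
  have h2 : C.1 ∪ D.1 ⊆ D.1 := hD.2 (y := ⟨C.1 ∪ D.1, h⟩) hS (Set.subset_union_right (s := C.1))
  exact hne (Subtype.ext (Set.Subset.antisymm (Set.subset_union_left.trans h2)
    (Set.subset_union_right.trans h1)))

end Components

/-- A folding `X ↪ Y`: an automorphism `aut` of the diagram of `Y` and a bijection `σ` of `X`
with the set `Y / aut` of `aut`-orbits which respects edges (with multiplicities and arrows): the
diagram of `X` is that of the subalgebra of `aut`-fixed points, whose simple roots are the
restrictions of the `α_y` and whose simple coroots are the sums of the `α_z^∨` over the orbits. -/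
structure Folding {X Y : Type*} [Fintype Y] (A : Matrix X X ℤ) (B : Matrix Y Y ℤ) where
  /-- the diagram automorphism of `Y` -/
  aut : Equiv.Perm Y
  aut_cartan : ∀ y z, B (aut y) (aut z) = B y z
  /-- the bijection with the set of orbits -/
  σ : X ≃ Quotient (Equiv.Perm.SameCycle.setoid aut)
  σ_cartan : ∀ (i j : X) (y : Y), σ i = Quotient.mk _ y →
    A i j = ∑ᶠ (z : Y) (_ : σ j = Quotient.mk _ z), B y z

namespace Folding

section Proj

variable {X Y : Type*} [DecidableEq X] [Fintype Y] {A : Matrix X X ℤ} {B : Matrix Y Y ℤ}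

/-- `σ(I)`, as a subset of `Y`: the union of the orbits `σ(i)`, `i ∈ I`. -/
def image (F : Folding A B) (I : Set X) : Set Y :=
  {y | ∃ i ∈ I, F.σ i = Quotient.mk _ y}

/-- The folding given by `aut` and by the map `π : Y → X` whose fibres are the orbits `σ(i)`. -/
def ofProj (aut : Equiv.Perm Y) (π : Y → X) (aut_cartan : ∀ y z, B (aut y) (aut z) = B y z)
    (hsurj : Function.Surjective π) (horb : ∀ y z, aut.SameCycle y z ↔ π y = π z)
    (hcartan : ∀ y j, A (π y) j = ∑ z with π z = j, B y z) : Folding A B where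
  aut := aut
  aut_cartan := aut_cartan
  σ := (Equiv.ofBijective
    (Quotient.lift (s := Equiv.Perm.SameCycle.setoid aut) π fun y z h => (horb y z).1 h)
    ⟨by
      intro a b
      induction a using Quotient.inductionOn
      induction b using Quotient.inductionOn
      exact fun h => Quotient.sound ((horb _ _).2 h),
    fun x => (hsurj x).elim fun y hy => ⟨Quotient.mk _ y, hy⟩⟩).symm
  σ_cartan := by
    intro i j y hy
    rw [Equiv.symm_apply_eq] at hy
    simp only [Equiv.symm_apply_eq]
    subst hy
    refine (hcartan y j).trans ?_
    rw [finsum_eq_sum_of_fintype, Finset.sum_filter]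
    refine Finset.sum_congr rfl fun z _ => ?_
    rw [finsum_eq_if]
    exact if_congr eq_comm rfl rfl

theorem mem_image_ofProj (aut : Equiv.Perm Y) (π : Y → X) (h1 : ∀ y z, B (aut y) (aut z) = B y z)
    (h2 : Function.Surjective π) (h3 : ∀ y z, aut.SameCycle y z ↔ π y = π z)
    (h4 : ∀ y j, A (π y) j = ∑ z with π z = j, B y z) (I : Set X) (y : Y) :
    y ∈ (ofProj aut π h1 h2 h3 h4).image I ↔ π y ∈ I := by
  constructor
  · rintro ⟨i, hi, h⟩
    have h' := (Equiv.symm_apply_eq _).1 h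
    rw [h'] at hi
    exact hi
  · exact fun h => ⟨π y, h, (Equiv.symm_apply_eq _).2 rfl⟩

end Proj

section General

variable {X Y : Type*} [Fintype X] [DecidableEq X] [Fintype Y] [DecidableEq Y]
  {A : Matrix X X ℤ} {B : Matrix Y Y ℤ}

/-- The product of the generators `s^Y_C` of the cactus group of `Y` over the connected components
`C` of `σ(I)`; these generators commute, so that their order does not matter. -/
def sTilde (F : Folding A B) (I : ConnSub A) : CactusGroup B :=
  (components B (F.image I.1)).noncommProd gen fun _ hC _ hD hne =>
    gen_comm _ _ (not_isConn_union hC hD hne)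

/-- The sets of nodes of `Y` of the form `σ(I)`, for `I` a connected subdiagram of `X`. -/
abbrev VirtualSub (F : Folding A B) : Type _ :=
  {S : Set Y // ∃ I : ConnSub A, F.image I.1 = S}

/-- The index `σ(I)` of a generator of the virtual cactus group. -/
def virtualSub (F : Folding A B) (I : ConnSub A) : F.VirtualSub :=
  ⟨F.image I.1, I, rfl⟩

/-- The defining relations of the virtual cactus group. -/
inductive VirtualRel (F : Folding A B) : FreeGroup F.VirtualSub → Prop
  | sq (I : ConnSub A) :
      VirtualRel F (FreeGroup.of (F.virtualSub I) * FreeGroup.of (F.virtualSub I))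
  | comm (I J : ConnSub A) (h : ¬ IsConn A (I.1 ∪ J.1)) :
      VirtualRel F ((FreeGroup.of (F.virtualSub I) * FreeGroup.of (F.virtualSub J)) *
        (FreeGroup.of (F.virtualSub J) * FreeGroup.of (F.virtualSub I))⁻¹)
  | conj (I J K : ConnSub A) (h : J.1 ⊆ I.1) (hK : IsThetaImage A I.1 J.1 K.1) :
      VirtualRel F ((FreeGroup.of (F.virtualSub I) * FreeGroup.of (F.virtualSub J)) *
        (FreeGroup.of (F.virtualSub K) * FreeGroup.of (F.virtualSub I))⁻¹)

/-- The virtual cactus group `J^v_X`. -/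
abbrev VirtualCactusGroup (F : Folding A B) : Type _ :=
  PresentedGroup {r | VirtualRel F r}

/-- The generator `s_{σ(I)}` of the virtual cactus group. -/
def virtualGen (F : Folding A B) (I : ConnSub A) : F.VirtualCactusGroup :=
  PresentedGroup.of (F.virtualSub I)

end General

/-! The foldings, with nodes numbered from `0`. -/

section Standard

theorem sameCycle_iff_of_involutive {α : Type*} (f : Equiv.Perm α) (hf : ∀ x, f (f x) = x)
    (x y : α) : f.SameCycle x y ↔ y = x ∨ y = f x := by
  have h2 : f * f = 1 := Equiv.ext hf
  constructor
  · rintro ⟨k, rfl⟩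
    obtain ⟨m, rfl | rfl⟩ := Int.even_or_odd' k
    · left
      rw [zpow_mul, zpow_two, h2, one_zpow, Equiv.Perm.one_apply]
    · right
      rw [zpow_add, zpow_mul, zpow_two, h2, one_zpow, one_mul, zpow_one]
  · rintro (rfl | rfl)
    · exact Equiv.Perm.SameCycle.refl f y
    · exact ⟨1, by simp⟩

/-- `C_n ⊂ A_{2n-1}`: `aut` is the reversal of the path, `σ(i) = {i, 2n-2-i}`. -/
def foldC (n : ℕ) (hn : 2 ≤ n) : Folding (CartanMatrix.C n) (CartanMatrix.A (2 * n - 1)) :=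
  ofProj Fin.revPerm (fun y => ⟨min y (2 * n - 2 - y), by omega⟩)
    (by
      intro y z
      simp only [CartanMatrix.A, Matrix.of_apply, Fin.revPerm_apply, Fin.ext_iff, Fin.val_rev]
      grind)
    (by
      intro x
      exact ⟨⟨x, by omega⟩, by ext; simp; omega⟩)
    (by
      intro y z
      rw [sameCycle_iff_of_involutive _ (by simp)]
      simp only [Fin.revPerm_apply, Fin.ext_iff, Fin.val_rev]
      omega)
    (by
      intro y j
      by_cases hj : (j : ℕ) = n - 1
      · have : (Finset.univ.filter fun z : Fin (2 * n - 1) =>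
            (⟨min z (2 * n - 2 - z), by omega⟩ : Fin n) = j) = {⟨n - 1, by omega⟩} := by
          ext z
          simp only [Finset.mem_filter, Finset.mem_univ, true_and, Finset.mem_singleton,
            Fin.ext_iff]
          omega
        rw [this, Finset.sum_singleton]
        simp only [CartanMatrix.A, CartanMatrix.C, Matrix.of_apply, Fin.ext_iff]
        split_ifs <;> omega
      · have : (Finset.univ.filter fun z : Fin (2 * n - 1) =>
            (⟨min z (2 * n - 2 - z), by omega⟩ : Fin n) = j) =
              {⟨j, by omega⟩, ⟨2 * n - 2 - j, by omega⟩} := by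
          ext z
          simp only [Finset.mem_filter, Finset.mem_univ, true_and, Finset.mem_singleton,
            Finset.mem_insert, Fin.ext_iff]
          omega
        rw [this, Finset.sum_pair (by simp only [ne_eq, Fin.ext_iff]; omega)]
        simp only [CartanMatrix.A, CartanMatrix.C, Matrix.of_apply, Fin.ext_iff]
        split_ifs <;> omega)

/-- The automorphism of `D_{n+1}` which exchanges the last two nodes. -/
def autD (n : ℕ) : Equiv.Perm (Fin (n + 1)) :=
  Equiv.swap ⟨n - 1, by omega⟩ ⟨n, by omega⟩

theorem autD_spec (n : ℕ) (hn : 2 ≤ n) (y : Fin (n + 1)) :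
    ((y : ℕ) = n - 1 ∧ (autD n y : ℕ) = n) ∨ ((y : ℕ) = n ∧ (autD n y : ℕ) = n - 1) ∨
      ((y : ℕ) < n - 1 ∧ (autD n y : ℕ) = y) := by
  simp only [autD, Equiv.swap_apply_def, Fin.ext_iff]
  split_ifs <;> simp <;> omega

theorem autD_cartan (n : ℕ) (hn : 2 ≤ n) (y z : Fin (n + 1)) :
    CartanMatrix.D (n + 1) (autD n y) (autD n z) = CartanMatrix.D (n + 1) y z := by
  have hy := autD_spec n hn y
  have hz := autD_spec n hn z
  generalize autD n y = a at *
  generalize autD n z = b at *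
  simp only [CartanMatrix.D, Matrix.of_apply, Fin.ext_iff]
  rw [if_congr (show (a : ℕ) = b ↔ (y : ℕ) = z by omega) rfl rfl]
  refine if_congr Iff.rfl rfl (if_congr Iff.rfl rfl ?_)
  refine if_congr (by omega) rfl (if_congr (by omega) rfl ?_)
  exact if_congr (by omega) rfl (if_congr (by omega) rfl rfl)

theorem autD_sameCycle (n : ℕ) (hn : 2 ≤ n) (y z : Fin (n + 1)) :
    (autD n).SameCycle y z ↔ min (y : ℕ) (n - 1) = min (z : ℕ) (n - 1) := by
  rw [sameCycle_iff_of_involutive _ (by simp [autD])]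
  have hy := autD_spec n hn y
  rw [Fin.ext_iff, Fin.ext_iff]
  omega

theorem D_apply_of_lt (n : ℕ) (y z : Fin (n + 1)) (hz : (z : ℕ) < n - 1) :
    CartanMatrix.D (n + 1) y z =
      if (y : ℕ) = z then 2 else if (y : ℕ) + 1 = z ∨ min (y : ℕ) (n - 1) = z + 1 then -1 else 0 := by
  have hy := y.isLt
  simp only [CartanMatrix.D, Matrix.of_apply, Fin.ext_iff]
  split_ifs <;> first | rfl | omega

theorem D_apply_of_le (n : ℕ) (hn : 2 ≤ n) (y z : Fin (n + 1)) (hz : n - 1 ≤ (z : ℕ)) :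
    CartanMatrix.D (n + 1) y z =
      if (y : ℕ) = z then 2 else if (y : ℕ) + 2 = n then -1 else 0 := by
  have hy := y.isLt
  have hz' := z.isLt
  simp only [CartanMatrix.D, Matrix.of_apply, Fin.ext_iff]
  split_ifs <;> first | rfl | omega

theorem foldB_cartan (n : ℕ) (hn : 2 ≤ n) (y : Fin (n + 1)) (j : Fin n) :
    CartanMatrix.B n ⟨min y (n - 1), by omega⟩ j =
      ∑ z ∈ Finset.univ.filter fun z : Fin (n + 1) => (⟨min z (n - 1), by omega⟩ : Fin n) = j,
        CartanMatrix.D (n + 1) y z := by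
  have hy := y.isLt
  have hj' := j.isLt
  by_cases hj : (j : ℕ) = n - 1
  · have : (Finset.univ.filter fun z : Fin (n + 1) =>
        (⟨min z (n - 1), by omega⟩ : Fin n) = j) = {⟨n - 1, by omega⟩, ⟨n, by omega⟩} := by
      ext z
      simp only [Finset.mem_filter, Finset.mem_univ, true_and, Finset.mem_singleton,
        Finset.mem_insert, Fin.ext_iff]
      omega
    rw [this, Finset.sum_pair (by simp only [ne_eq, Fin.ext_iff]; omega),
      D_apply_of_le n hn _ _ le_rfl, D_apply_of_le n hn _ _ (Nat.sub_le n 1)]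
    simp only [CartanMatrix.B, Matrix.of_apply, Fin.ext_iff]
    split_ifs <;> first | rfl | omega
  · have : (Finset.univ.filter fun z : Fin (n + 1) =>
        (⟨min z (n - 1), by omega⟩ : Fin n) = j) = {⟨j, by omega⟩} := by
      ext z
      simp only [Finset.mem_filter, Finset.mem_univ, true_and, Finset.mem_singleton,
        Fin.ext_iff]
      omega
    have hlt : (j : ℕ) < n - 1 := by omega
    rw [this, Finset.sum_singleton, D_apply_of_lt n _ _ hlt]
    simp only [CartanMatrix.B, Matrix.of_apply, Fin.ext_iff]
    split_ifs <;> first | rfl | omega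

/-- `B_n ⊂ D_{n+1}`: `aut` exchanges the last two nodes, `σ(n-1) = {n-1, n}` and `σ(i) = {i}`
for `i < n-1`. -/
def foldB (n : ℕ) (hn : 2 ≤ n) : Folding (CartanMatrix.B n) (CartanMatrix.D (n + 1)) :=
  ofProj (autD n) (fun y => ⟨min y (n - 1), by omega⟩) (autD_cartan n hn)
    (fun x => ⟨⟨x, by omega⟩, by ext; simp; omega⟩)
    (fun y z => by rw [autD_sameCycle n hn, Fin.mk.injEq])
    (foldB_cartan n hn)

/-- The automorphism of `D_4` which rotates the three legs. -/
def triality : Equiv.Perm (Fin 4) :=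
  Equiv.swap 0 2 * Equiv.swap 2 3

/-- The nontrivial automorphism of `E_6`. -/
def autE : Equiv.Perm (Fin 6) :=
  Equiv.swap 0 5 * Equiv.swap 2 4

theorem triality_cartan :
    (CartanMatrix.D 4).submatrix triality triality = CartanMatrix.D 4 := by
  decide

theorem autE_cartan : CartanMatrix.E₆.submatrix autE autE = CartanMatrix.E₆ := by
  decide

/-- `G_2 ⊂ D_4`: `aut` rotates the three legs, `σ(0) = {0, 2, 3}` and `σ(1) = {1}`; the
node `0` of `G_2` is the short simple root, whence the transpose of Mathlib's matrix. -/
def foldG : Folding (CartanMatrix.G₂.transpose) (CartanMatrix.D 4) :=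
  ofProj triality ![0, 1, 0, 0]
    (fun y z => congrFun (congrFun triality_cartan y) z)
    (by decide) (by decide) (by decide)

/-- `F_4 ⊂ E_6`: `aut` is the nontrivial automorphism of `E_6`, and `σ(0) = {1}`, `σ(1) = {3}`,
`σ(2) = {2, 4}`, `σ(3) = {0, 5}`. -/
def foldF : Folding CartanMatrix.F₄ CartanMatrix.E₆ :=
  ofProj autE ![3, 0, 2, 1, 2, 3]
    (fun y z => congrFun (congrFun autE_cartan y) z)
    (by decide)
    (fun y z => by rw [sameCycle_iff_of_involutive _ (by decide)]; revert y z; decide)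
    (by decide)

/-- The list of foldings of a twisted diagram `X` into a simply laced diagram `Y`. -/
inductive IsStandard : ∀ {m k : ℕ} {A : Matrix (Fin m) (Fin m) ℤ} {B : Matrix (Fin k) (Fin k) ℤ},
    Folding A B → Prop
  | C (n : ℕ) (hn : 2 ≤ n) : IsStandard (foldC n hn)
  | B (n : ℕ) (hn : 2 ≤ n) : IsStandard (foldB n hn)
  | G : IsStandard foldG
  | F : IsStandard foldF

end Standard

end Folding

end Dynkin

end

/-!
The cactus group `J_Y` acts on the right-angled Coxeter group whose letters are sets of vectors of
the root lattice, two letters commuting when they are nested or orthogonal: the generator `s_I`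
applies the longest element of `W^I` to every letter and then multiplies from the left by the span
of the simple roots `αᵢ`, `i ∈ I`.

The linear map of root lattices which sends `α_y` to `αᵢ` for `y ∈ σ(i)` maps the roots of `Y` onto
the roots of `X`, and it intertwines the longest elements of `W^{σ(I)}` and `W^I`. Hence
`θ_{σ(I)}` covers `θ_I`, which gives the relations between the `s̃_I`.

Let `l` be a shortest word for an element of `J_X`, and apply its image in `J_Y` to the empty word.
If two letters cancelled in the process, coming from components of `σ(I)` and `σ(K)`, then the
longest elements in between would map one component to the other. Each component of `σ(I)` projects
onto `I`, so the same would hold for `I` and `K` downstairs, and `l` could be shortened. Thus the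
image of an element other than `1` moves the empty word.
-/

noncomputable section

namespace Dynkin

/-! ### Reduced words in right-angled Coxeter groups -/

section Words

variable {V : Type*} {c : V → V → Prop}

/-- Some occurrence of the letter `p` in the word can be moved to the front of the word past letters
commuting with `p`, so that it cancels in the product of `p` and the word. -/
def Cancels (c : V → V → Prop) (p : V) : List V → Prop
  | [] => False
  | x :: w => x = p ∨ (c p x ∧ Cancels c p w)

/-- The word is reduced in the right-angled Coxeter group with commutation relation `c`: no letter
cancels against a later one. -/
def Reduced (c : V → V → Prop) : List V → Prop
  | [] => True
  | x :: w => ¬ Cancels c x w ∧ Reduced c w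

/-- Equality of words up to exchanging neighbours which commute. -/
inductive TraceEquiv (c : V → V → Prop) : List V → List V → Prop
  | refl (w : List V) : TraceEquiv c w w
  | symm {u w : List V} : TraceEquiv c u w → TraceEquiv c w u
  | trans {u v w : List V} : TraceEquiv c u v → TraceEquiv c v w → TraceEquiv c u w
  | cons (p : V) {u w : List V} : TraceEquiv c u w → TraceEquiv c (p :: u) (p :: w)
  | swap {p q : V} (h : c p q) (w : List V) : TraceEquiv c (p :: q :: w) (q :: p :: w)

theorem reduced_nil : Reduced c [] := trivial

theorem TraceEquiv.perm {u w : List V} (h : TraceEquiv c u w) : u.Perm w := by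
  induction h with
  | refl w => exact .refl w
  | symm _ ih => exact ih.symm
  | trans _ _ ih ih' => exact ih.trans ih'
  | cons p _ ih => exact ih.cons p
  | swap _ w => exact .swap _ _ w

theorem TraceEquiv.map {V' : Type*} {c' : V' → V' → Prop} (f : c →r c') {u w : List V}
    (h : TraceEquiv c u w) : TraceEquiv c' (u.map f) (w.map f) := by
  induction h with
  | refl w => exact .refl _
  | symm _ ih => exact ih.symm
  | trans _ _ ih ih' => exact ih.trans ih'
  | cons p _ ih => exact ih.cons (f p)
  | swap h w => exact .swap (f.map_rel h) _

theorem TraceEquiv.erase [DecidableEq V] {u w : List V} (h : TraceEquiv c u w) (p : V) :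
    TraceEquiv c (u.erase p) (w.erase p) := by
  induction h with
  | refl w => exact .refl _
  | symm _ ih => exact ih.symm
  | trans _ _ ih ih' => exact ih.trans ih'
  | @cons x u w h ih =>
    by_cases hx : x = p
    · simpa [hx] using h
    · simpa [List.erase_cons, hx] using ih.cons x
  | @swap x y h w =>
    by_cases hx : x = p <;> by_cases hy : y = p <;>
      simp only [List.erase_cons, hx, hy, beq_self_eq_true, beq_iff_eq, if_true, if_false]
    · exact .refl _
    · exact .refl _
    · exact .refl _
    · exact .swap h _

theorem Cancels.cons_iff {p x : V} (hx : x ≠ p) (h : c p x) (w : List V) :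
    Cancels c p (x :: w) ↔ Cancels c p w := by
  simp [Cancels, hx, h]

theorem Cancels.of_append {p : V} {u w : List V} (h : Cancels c p (u ++ w)) :
    p ∈ u ∨ (∀ x ∈ u, c p x) ∧ Cancels c p w := by
  induction u with
  | nil => exact .inr ⟨by simp, h⟩
  | cons x u ih =>
    rcases h with rfl | ⟨hx, h⟩
    · exact .inl List.mem_cons_self
    · exact (ih h).imp (List.mem_cons_of_mem x) (And.imp_left fun hu => by simpa [hx] using hu)

theorem cancels_map_iff {V' : Type*} {c' : V' → V' → Prop} (f : c ↪r c') (p : V) (w : List V) :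
    Cancels c' (f p) (w.map f) ↔ Cancels c p w := by
  induction w with
  | nil => rfl
  | cons x w ih => simp [Cancels, ih, f.map_rel_iff]

theorem reduced_map_iff {V' : Type*} {c' : V' → V' → Prop} (f : c ↪r c') (w : List V) :
    Reduced c' (w.map f) ↔ Reduced c w := by
  induction w with
  | nil => rfl
  | cons x w ih => simp [Reduced, cancels_map_iff f, ih]

theorem Reduced.not_cancels_erase [DecidableEq V] {p : V} {w : List V} (hw : Reduced c w)
    (h : Cancels c p w) : ¬ Cancels c p (w.erase p) := by
  induction w with
  | nil => exact h.elim
  | cons x w ih =>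
    by_cases hx : x = p
    · subst hx
      simpa using hw.1
    · obtain ⟨hpx, h⟩ := h.resolve_left hx
      rw [List.erase_cons_tail (by simpa using hx), Cancels.cons_iff hx hpx]
      exact ih hw.2 h

theorem Cancels.equiv_cons_erase [DecidableEq V] {p : V} {w : List V} (h : Cancels c p w) :
    TraceEquiv c (p :: w.erase p) w := by
  induction w with
  | nil => exact h.elim
  | cons x w ih =>
    by_cases hx : x = p
    · simp only [hx, List.erase_cons_head]
      exact .refl _
    · obtain ⟨hpx, h⟩ := h.resolve_left hx
      rw [List.erase_cons_tail (by simpa using hx)]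
      exact (TraceEquiv.swap hpx _).trans ((ih h).cons x)

open Classical in
/-- The reduced word of the product of the letter `p` and the reduced word `w`. -/
def wordAct (c : V → V → Prop) (p : V) (w : List V) : List V :=
  if Cancels c p w then w.erase p else p :: w

theorem wordAct_of_cancels [DecidableEq V] {p : V} {w : List V} (h : Cancels c p w) :
    wordAct c p w = w.erase p := by
  rw [wordAct, if_pos h]
  congr!

theorem wordAct_of_not_cancels {p : V} {w : List V} (h : ¬ Cancels c p w) :
    wordAct c p w = p :: w := if_neg h

theorem map_wordAct {V' : Type*} {c' : V' → V' → Prop} (f : c ↪r c') (p : V) (w : List V) :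
    (wordAct c p w).map f = wordAct c' (f p) (w.map f) := by
  classical
  by_cases h : Cancels c p w
  · rw [wordAct_of_cancels h, wordAct_of_cancels ((cancels_map_iff f p w).2 h),
      List.map_erase f.injective]
  · rw [wordAct_of_not_cancels h, wordAct_of_not_cancels (mt (cancels_map_iff f p w).1 h),
      List.map_cons]

theorem wordAct_wordAct_self (p : V) {w : List V} (hw : Reduced c w) :
    TraceEquiv c (wordAct c p (wordAct c p w)) w := by
  classical
  by_cases h : Cancels c p w
  · rw [wordAct_of_cancels h, wordAct_of_not_cancels (hw.not_cancels_erase h)]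
    exact h.equiv_cons_erase
  · have hp : Cancels c p (p :: w) := Or.inl rfl
    rw [wordAct_of_not_cancels h, wordAct_of_cancels hp, List.erase_cons_head]
    exact .refl w

section Symm

variable [Std.Symm c]

theorem Cancels.congr {p : V} {u w : List V} (h : TraceEquiv c u w) :
    Cancels c p u ↔ Cancels c p w := by
  induction h with
  | refl w => rfl
  | symm _ ih => exact ih.symm
  | trans _ _ ih ih' => exact ih.trans ih'
  | cons x _ ih => exact or_congr_right (and_congr_right fun _ => ih)
  | @swap x y hxy w =>
    have hyx : c y x := symm_of c hxy
    simp only [Cancels]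
    grind

theorem Cancels.erase_iff [DecidableEq V] {p q : V} (hne : p ≠ q) (hc : c p q) {w : List V}
    (h : Cancels c p w) : Cancels c q (w.erase p) ↔ Cancels c q w := by
  rw [← Cancels.congr h.equiv_cons_erase, Cancels.cons_iff hne (symm_of c hc)]

theorem cancels_wordAct_iff {p q : V} (hne : p ≠ q) (hc : c p q) (w : List V) :
    Cancels c q (wordAct c p w) ↔ Cancels c q w := by
  classical
  by_cases h : Cancels c p w
  · rw [wordAct_of_cancels h, h.erase_iff hne hc]
  · rw [wordAct_of_not_cancels h, Cancels.cons_iff hne (symm_of c hc)]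

theorem Reduced.erase [DecidableEq V] {p : V} {w : List V} (hw : Reduced c w)
    (h : Cancels c p w) : Reduced c (w.erase p) := by
  induction w with
  | nil => exact h.elim
  | cons x w ih =>
    by_cases hx : x = p
    · subst hx
      simpa using hw.2
    · obtain ⟨hpx, h⟩ := h.resolve_left hx
      rw [List.erase_cons_tail (by simpa using hx)]
      exact ⟨mt (h.erase_iff (Ne.symm hx) hpx).1 hw.1, ih hw.2 h⟩

theorem Reduced.wordAct (p : V) {w : List V} (hw : Reduced c w) : Reduced c (wordAct c p w) := by
  classical
  by_cases h : Cancels c p w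
  · rw [wordAct_of_cancels h]
    exact hw.erase h
  · rw [wordAct_of_not_cancels h]
    exact ⟨h, hw⟩

theorem TraceEquiv.wordAct (p : V) {u w : List V} (h : TraceEquiv c u w) :
    TraceEquiv c (wordAct c p u) (wordAct c p w) := by
  classical
  by_cases hp : Cancels c p u
  · rw [wordAct_of_cancels hp, wordAct_of_cancels ((Cancels.congr h).1 hp)]
    exact h.erase p
  · rw [wordAct_of_not_cancels hp, wordAct_of_not_cancels (mt (Cancels.congr h).2 hp)]
    exact h.cons p

theorem wordAct_comm {p q : V} (hc : c p q) (w : List V) :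
    TraceEquiv c (wordAct c p (wordAct c q w)) (wordAct c q (wordAct c p w)) := by
  classical
  obtain rfl | hne := eq_or_ne p q
  · exact .refl _
  have hq' := cancels_wordAct_iff hne hc w
  have hp' := cancels_wordAct_iff hne.symm (symm_of c hc) w
  by_cases hp : Cancels c p w <;> by_cases hq : Cancels c q w
  · rw [wordAct_of_cancels (hp'.2 hp), wordAct_of_cancels (hq'.2 hq), wordAct_of_cancels hp,
      wordAct_of_cancels hq, List.erase_comm]
    exact .refl _
  · rw [wordAct_of_cancels (hp'.2 hp), wordAct_of_not_cancels (mt hq'.1 hq), wordAct_of_cancels hp,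
      wordAct_of_not_cancels hq, List.erase_cons_tail (by simpa using hne.symm)]
    exact .refl _
  · rw [wordAct_of_not_cancels (mt hp'.1 hp), wordAct_of_cancels (hq'.2 hq),
      wordAct_of_not_cancels hp, wordAct_of_cancels hq, List.erase_cons_tail (by simpa using hne)]
    exact .refl _
  · rw [wordAct_of_not_cancels (mt hp'.1 hp), wordAct_of_not_cancels (mt hq'.1 hq),
      wordAct_of_not_cancels hp, wordAct_of_not_cancels hq]
    exact .swap hc w

end Symm

/-- Equality of reduced words up to exchanging neighbours which commute. -/
def traceSetoid (c : V → V → Prop) : Setoid {w : List V // Reduced c w} where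
  r w w' := TraceEquiv c w.1 w'.1
  iseqv := ⟨fun w => .refl w.1, .symm, .trans⟩

/-- The right-angled Coxeter group with commutation relation `c`, as the set of its reduced words
up to exchanging neighbours which commute. -/
abbrev Trace (c : V → V → Prop) : Type _ := Quotient (traceSetoid c)

namespace Trace

/-- The element of the right-angled Coxeter group given by a reduced word. -/
def mk (w : List V) (hw : Reduced c w) : Trace c := Quotient.mk (traceSetoid c) ⟨w, hw⟩

theorem mk_eq_mk {u w : List V} {hu : Reduced c u} {hw : Reduced c w} :
    mk u hu = mk w hw ↔ TraceEquiv c u w :=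
  Quotient.eq (r := traceSetoid c)

theorem mk_eq_mk_nil {w : List V} {hw : Reduced c w} :
    mk w hw = mk [] reduced_nil ↔ w = [] := by
  rw [mk_eq_mk]
  refine ⟨fun h => h.perm.eq_nil, ?_⟩
  rintro rfl
  exact .refl []

/-- The action on the right-angled Coxeter group of the permutations of the letters which respect
the commutation relation. -/
def mapPerm (c : V → V → Prop) : (c ≃r c) →* Equiv.Perm (Trace c) :=
  MonoidHom.toHomPerm
    { toFun := fun f => Quotient.map'
        (fun w => ⟨w.1.map f, (reduced_map_iff f.toRelEmbedding w.1).2 w.2⟩)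
        fun _ _ h => h.map f.toRelEmbedding.toRelHom
      map_one' := by
        funext t
        obtain ⟨w, hw⟩ := t
        exact mk_eq_mk.2 (by simpa using .refl w)
      map_mul' := fun f g => by
        funext t
        obtain ⟨w, hw⟩ := t
        exact mk_eq_mk.2 (by simpa using .refl _) }

theorem mapPerm_mk (f : c ≃r c) {w : List V} (hw : Reduced c w) :
    mapPerm c f (mk w hw) = mk (w.map f) ((reduced_map_iff f.toRelEmbedding w).2 hw) := rfl

variable [Std.Symm c]

theorem act_involutive (p : V) : Function.Involutive
    (Quotient.map' (fun w => ⟨wordAct c p w.1, w.2.wordAct p⟩) fun _ _ h => h.wordAct p :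
      Trace c → Trace c) := by
  rintro ⟨w, hw⟩
  exact mk_eq_mk.2 (wordAct_wordAct_self p hw)

/-- Left multiplication by a letter in the right-angled Coxeter group. -/
def actPerm (p : V) : Equiv.Perm (Trace c) :=
  (act_involutive p).toPerm

theorem actPerm_mk (p : V) {w : List V} (hw : Reduced c w) :
    actPerm p (mk w hw) = mk (wordAct c p w) (hw.wordAct p) := rfl

theorem actPerm_mul_self (p : V) : (actPerm p * actPerm p : Equiv.Perm (Trace c)) = 1 :=
  Equiv.ext (act_involutive p)

theorem actPerm_comm {p q : V} (h : c p q) :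
    Commute (actPerm p : Equiv.Perm (Trace c)) (actPerm q) := by
  refine Equiv.ext ?_
  rintro ⟨w, hw⟩
  exact mk_eq_mk.2 (wordAct_comm h w)

theorem mapPerm_mul_actPerm (f : c ≃r c) (p : V) :
    mapPerm c f * actPerm p = actPerm (f p) * mapPerm c f := by
  refine Equiv.ext ?_
  rintro ⟨w, hw⟩
  exact congrArg (Quotient.mk _) (Subtype.ext (map_wordAct f.toRelEmbedding p w))

theorem mapPerm_mul_prod_actPerm (f : c ≃r c) (u : List V) :
    mapPerm c f * (u.map actPerm).prod = ((u.map f).map actPerm).prod * mapPerm c f := by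
  induction u with
  | nil => simp
  | cons p u ih =>
    simp only [List.map_cons, List.prod_cons]
    rw [← mul_assoc, mapPerm_mul_actPerm, mul_assoc, ih, mul_assoc]

theorem prod_actPerm_mk {u w : List V} (hu : u.Nodup) (hw : Reduced c w)
    (huw : ∀ p ∈ u, ¬ Cancels c p w) :
    ∃ h : Reduced c (u ++ w), (u.map actPerm).prod (mk w hw) = mk (u ++ w) h := by
  induction u with
  | nil => exact ⟨hw, rfl⟩
  | cons p u ih =>
    obtain ⟨hr, heq⟩ := ih hu.of_cons fun q hq => huw q (List.mem_cons_of_mem p hq)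
    have hp : ¬ Cancels c p (u ++ w) := fun h =>
      h.of_append.elim hu.notMem fun h' => huw p List.mem_cons_self h'.2
    refine ⟨⟨hp, hr⟩, ?_⟩
    rw [List.map_cons, List.prod_cons, Equiv.Perm.mul_apply, heq, actPerm_mk]
    simp only [wordAct_of_not_cancels hp, List.cons_append]

end Trace

end Words

/-! ### Root systems and longest elements -/

section Roots

variable {ι : Type*}

theorem sum_smul_simpleRoot [Fintype ι] [DecidableEq ι] (v : ι → ℤ) :
    ∑ i, v i • simpleRoot i = v := by
  ext k
  simp [simpleRoot, Finset.sum_apply, Pi.single_apply]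

section SimpleRoot

variable [DecidableEq ι]

theorem simpleRoot_self (i : ι) : simpleRoot i i = 1 := Pi.single_eq_same i 1

theorem simpleRoot_of_ne {i k : ι} (h : k ≠ i) : simpleRoot i k = 0 := Pi.single_eq_of_ne h 1

theorem simpleRoot_injective : Function.Injective (simpleRoot : ι → ι → ℤ) := fun i j h =>
  not_imp_comm.1 simpleRoot_of_ne (by rw [← h, simpleRoot_self]; exact one_ne_zero)

theorem simpleRoot_nonneg (i : ι) : 0 ≤ (simpleRoot i : ι → ℤ) :=
  Pi.single_nonneg.2 zero_le_one

theorem simpleRoot_ne_zero (i : ι) : (simpleRoot i : ι → ℤ) ≠ 0 := by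
  simp [simpleRoot]

theorem not_simpleRoot_nonpos (i : ι) : ¬ (simpleRoot i : ι → ℤ) ≤ 0 := fun h =>
  simpleRoot_ne_zero i (le_antisymm h (simpleRoot_nonneg i))

theorem eq_simpleRoot_of_le {v : ι → ℤ} {i : ι} (hne : v ≠ 0) (h0 : 0 ≤ v)
    (hle : v ≤ simpleRoot i) : v = simpleRoot i := by
  have hoff : ∀ k, k ≠ i → v k = 0 := fun k hk =>
    le_antisymm ((hle k).trans (simpleRoot_of_ne hk).le) (h0 k)
  have hvi : v i ≠ 0 := fun hz => hne (funext fun k => by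
    obtain rfl | hk := eq_or_ne k i
    exacts [hz, hoff k hk])
  funext k
  obtain rfl | hk := eq_or_ne k i
  · have h1 := hle k
    have h2 : 0 ≤ v k := h0 k
    rw [simpleRoot_self] at h1 ⊢
    exact le_antisymm h1 (Int.add_one_le_iff.2 (h2.lt_of_ne' hvi))
  · rw [hoff k hk, simpleRoot_of_ne hk]

end SimpleRoot

/-- `d` symmetrizes the matrix `A`, whose diagonal entries are `2`. -/
structure IsSymmetrizable (A : Matrix ι ι ℤ) (d : ι → ℤ) : Prop where
  diag : ∀ i, A i i = 2
  pos : ∀ i, 0 < d i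
  symm : ∀ i j, A i j * d j = A j i * d i

section Form

variable [Fintype ι]

theorem simpleCoroot_apply (A : Matrix ι ι ℤ) (i : ι) (v : ι → ℤ) :
    simpleCoroot A i v = ∑ k, v k * A k i := rfl

/-- The bilinear form with `(αᵢ, αⱼ) = A i j * d j` on the root lattice, which is symmetric and
invariant under the Weyl group when `d` symmetrizes `A`. -/
def form (A : Matrix ι ι ℤ) (d : ι → ℤ) : (ι → ℤ) →ₗ[ℤ] (ι → ℤ) →ₗ[ℤ] ℤ :=
  ∑ j, d j • (LinearMap.mul ℤ ℤ).compl₁₂ (simpleCoroot A j) (LinearMap.proj j)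

theorem form_apply (A : Matrix ι ι ℤ) (d : ι → ℤ) (u v : ι → ℤ) :
    form A d u v = ∑ j, d j * (simpleCoroot A j u * v j) := by
  simp [form, LinearMap.sum_apply]

theorem form_simpleRoot_right [DecidableEq ι] (A : Matrix ι ι ℤ) (d : ι → ℤ) (u : ι → ℤ) (i : ι) :
    form A d u (simpleRoot i) = d i * simpleCoroot A i u := by
  simp [form_apply, simpleRoot, Pi.single_apply]

theorem IsSymmetrizable.form_comm {A : Matrix ι ι ℤ} {d : ι → ℤ} (h : IsSymmetrizable A d)
    (u v : ι → ℤ) : form A d u v = form A d v u := by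
  simp only [form_apply, simpleCoroot_apply, Finset.sum_mul, Finset.mul_sum]
  rw [Finset.sum_comm]
  refine Finset.sum_congr rfl fun i _ => Finset.sum_congr rfl fun j _ => ?_
  linear_combination u i * v j * h.symm i j

end Form

variable [Fintype ι] [DecidableEq ι]

theorem simpleReflection_apply (A : Matrix ι ι ℤ) (i : ι) (v : ι → ℤ) :
    simpleReflection A i v = v - simpleCoroot A i v • simpleRoot i := rfl

theorem simpleReflection_apply_of_ne (A : Matrix ι ι ℤ) {i k : ι} (h : k ≠ i) (v : ι → ℤ) :
    simpleReflection A i v k = v k := by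
  simp [simpleReflection_apply, simpleRoot_of_ne h]

section Parabolic

variable {A : Matrix ι ι ℤ} {I : Set ι} {w : Module.End ℤ (ι → ℤ)}

theorem simpleReflection_mem_parabolic (A : Matrix ι ι ℤ) {I : Set ι} {i : ι} (hi : i ∈ I) :
    simpleReflection A i ∈ parabolic A I :=
  Submonoid.subset_closure ⟨i, hi, rfl⟩

theorem parabolic_mono (A : Matrix ι ι ℤ) {I J : Set ι} (h : I ⊆ J) :
    parabolic A I ≤ parabolic A J :=
  Submonoid.closure_mono (Set.image_mono h)

theorem mem_parabolic_iff :
    w ∈ parabolic A I ↔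
      ∃ l : List ι, (∀ i ∈ l, i ∈ I) ∧ (l.map (simpleReflection A)).prod = w := by
  constructor
  · intro h
    induction h using Submonoid.closure_induction_left with
    | one => exact ⟨[], by simp, by simp⟩
    | mul_left x hx y _ ih =>
      obtain ⟨i, hi, rfl⟩ := hx
      obtain ⟨l, hl, rfl⟩ := ih
      exact ⟨i :: l, by simpa using ⟨hi, hl⟩, by simp⟩
  · rintro ⟨l, hl, rfl⟩
    refine Submonoid.list_prod_mem _ fun x hx => ?_
    obtain ⟨i, hi, rfl⟩ := List.mem_map.1 hx
    exact simpleReflection_mem_parabolic A (hl i hi)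

theorem apply_of_notMem (hw : w ∈ parabolic A I) (v : ι → ℤ) {k : ι} (hk : k ∉ I) :
    w v k = v k := by
  induction hw using Submonoid.closure_induction_left with
  | one => rfl
  | mul_left x hx y _ ih =>
    obtain ⟨i, hi, rfl⟩ := hx
    rw [Module.End.mul_apply, simpleReflection_apply_of_ne A (fun h => hk (by rwa [h])), ih]

theorem apply_simpleRoot_of_notMem (hw : w ∈ parabolic A I) {i k : ι} (hi : i ∈ I) (hk : k ∉ I) :
    w (simpleRoot i) k = 0 := by
  rw [apply_of_notMem hw _ hk, simpleRoot_of_ne]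
  rintro rfl
  exact hk hi

/-- `w` is an element of `W^I` which maps the simple roots `αᵢ`, `i ∈ I`, to negative vectors. For a
finite root system this characterizes the longest element of `W^I`. -/
def NegatesSimple (A : Matrix ι ι ℤ) (I : Set ι) (w : Module.End ℤ (ι → ℤ)) : Prop :=
  w ∈ parabolic A I ∧ ∀ i ∈ I, w (simpleRoot i) ≤ 0

theorem NegatesSimple.one : NegatesSimple A ∅ 1 :=
  ⟨one_mem _, fun _ hi => hi.elim⟩

theorem NegatesSimple.apply_nonpos (hw : NegatesSimple A I w) {v : ι → ℤ} (h0 : 0 ≤ v)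
    (hv : ∀ i, i ∉ I → v i = 0) : w v ≤ 0 := by
  rw [← sum_smul_simpleRoot v, map_sum]
  refine Finset.sum_nonpos fun i _ => ?_
  rw [map_smul]
  by_cases hi : i ∈ I
  · exact smul_nonpos_of_nonneg_of_nonpos (h0 i) (hw.2 i hi)
  · simp [hv i hi]

end Parabolic

/-- The positive roots, among the roots `Φ`, which `w` maps to negative ones. -/
def inversions (Φ : Set (ι → ℤ)) (w : Module.End ℤ (ι → ℤ)) : Set (ι → ℤ) :=
  {v | v ∈ Φ ∧ 0 ≤ v ∧ w v ≤ 0}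

/-- `Φ` is a finite reduced set of roots for the Weyl group of `A`, and `d` symmetrizes `A`. Of
reducedness only what is needed is recorded: a root proportional to `αᵢ` is at most `αᵢ`. -/
structure IsRootDatum (A : Matrix ι ι ℤ) (d : ι → ℤ) (Φ : Set (ι → ℤ)) : Prop
    extends IsSymmetrizable A d where
  finite : Φ.Finite
  simple : ∀ i, simpleRoot i ∈ Φ
  refl : ∀ i, ∀ v ∈ Φ, simpleReflection A i v ∈ Φ
  ne_zero : ∀ v ∈ Φ, v ≠ 0
  sign : ∀ v ∈ Φ, 0 ≤ v ∨ v ≤ 0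
  reduced : ∀ v ∈ Φ, ∀ i, (∀ j, j ≠ i → v j = 0) → v i ≤ 1

variable {A : Matrix ι ι ℤ} {d : ι → ℤ} {Φ : Set (ι → ℤ)} {I : Set ι}

namespace IsSymmetrizable

theorem form_simpleRoot_left (h : IsSymmetrizable A d) (u : ι → ℤ) (i : ι) :
    form A d (simpleRoot i) u = d i * simpleCoroot A i u := by
  rw [h.form_comm, form_simpleRoot_right]

theorem form_simpleReflection (h : IsSymmetrizable A d) (i : ι) (u v : ι → ℤ) :
    form A d (simpleReflection A i u) (simpleReflection A i v) = form A d u v := by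
  simp only [simpleReflection_apply, map_sub, map_smul, LinearMap.sub_apply, LinearMap.smul_apply,
    h.form_simpleRoot_left, form_simpleRoot_right, simpleCoroot_simpleRoot, h.diag, smul_eq_mul]
  ring

theorem form_apply_apply (h : IsSymmetrizable A d) {w : Module.End ℤ (ι → ℤ)}
    (hw : w ∈ parabolic A I) (u v : ι → ℤ) : form A d (w u) (w v) = form A d u v := by
  induction hw using Submonoid.closure_induction_left with
  | one => rfl
  | mul_left x hx y _ ih =>
    obtain ⟨i, -, rfl⟩ := hx
    rw [Module.End.mul_apply, Module.End.mul_apply, h.form_simpleReflection, ih]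

theorem reflection_mul_self (h : IsSymmetrizable A d) (i : ι) :
    simpleReflection A i * simpleReflection A i = 1 :=
  simpleReflection_mul_self A i (h.diag i)

theorem reflection_simpleRoot (h : IsSymmetrizable A d) (i : ι) :
    simpleReflection A i (simpleRoot i) = -simpleRoot i := by
  rw [simpleReflection_simpleRoot, h.diag, two_smul]
  abel

theorem reflection_reflection (h : IsSymmetrizable A d) (i : ι) (v : ι → ℤ) :
    simpleReflection A i (simpleReflection A i v) = v :=
  LinearMap.congr_fun (h.reflection_mul_self i) v

theorem mul_reflection_of_apply (h : IsSymmetrizable A d) {w : Module.End ℤ (ι → ℤ)}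
    (hw : w ∈ parabolic A I) {i k : ι} {e : ℤ} (he : e * e = 1)
    (hik : w (simpleRoot i) = e • simpleRoot k) :
    w * simpleReflection A i = simpleReflection A k * w := by
  have hd : d i = d k := by
    have := h.form_apply_apply hw (simpleRoot i) (simpleRoot i)
    simp only [hik, map_smul, LinearMap.smul_apply, form_simpleRoot_right,
      simpleCoroot_simpleRoot, h.diag, smul_eq_mul] at this
    linarith [congrArg (· * (d k * 2)) he]
  refine LinearMap.ext fun v => ?_
  have hf := h.form_apply_apply hw v (simpleRoot i)
  rw [hik, map_smul, form_simpleRoot_right, form_simpleRoot_right, hd, smul_eq_mul] at hf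
  have hc : e * simpleCoroot A k (w v) = simpleCoroot A i v :=
    mul_left_cancel₀ (h.pos k).ne' (by linear_combination hf)
  simp only [Module.End.mul_apply, simpleReflection_apply, map_sub, map_smul, hik, smul_smul]
  rw [← hc, mul_comm, ← mul_assoc, he, one_mul]

end IsSymmetrizable

namespace IsRootDatum

theorem apply_mem (h : IsRootDatum A d Φ) {w : Module.End ℤ (ι → ℤ)}
    (hw : w ∈ parabolic A I) {v : ι → ℤ} (hv : v ∈ Φ) : w v ∈ Φ := by
  induction hw using Submonoid.closure_induction_left with
  | one => exact hv
  | mul_left x hx y _ ih =>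
    obtain ⟨i, -, rfl⟩ := hx
    exact h.refl i _ ih

theorem apply_simpleRoot_mem (h : IsRootDatum A d Φ) {w : Module.End ℤ (ι → ℤ)}
    (hw : w ∈ parabolic A I) (i : ι) : w (simpleRoot i) ∈ Φ :=
  h.apply_mem hw (h.simple i)

theorem exists_ne_apply_ne_zero (h : IsRootDatum A d Φ) {i : ι} {v : ι → ℤ} (hv : v ∈ Φ)
    (h0 : 0 ≤ v) (hne : v ≠ simpleRoot i) : ∃ j, j ≠ i ∧ v j ≠ 0 := by
  by_contra! hall
  refine hne (eq_simpleRoot_of_le (h.ne_zero v hv) h0 fun j => ?_)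
  obtain rfl | hj := eq_or_ne j i
  · rw [simpleRoot_self]
    exact h.reduced v hv j hall
  · rw [hall j hj, simpleRoot_of_ne hj]

theorem reflection_nonneg (h : IsRootDatum A d Φ) {i : ι} {v : ι → ℤ} (hv : v ∈ Φ) (h0 : 0 ≤ v)
    (hne : v ≠ simpleRoot i) : 0 ≤ simpleReflection A i v := by
  obtain ⟨j, hj, hvj⟩ := h.exists_ne_apply_ne_zero hv h0 hne
  refine (h.sign _ (h.refl i v hv)).resolve_right fun hle => ?_
  have hle := hle j
  rw [simpleReflection_apply_of_ne A hj] at hle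
  exact hvj (le_antisymm hle (h0 j))

theorem exists_deletion (h : IsRootDatum A d Φ) (l : List ι) (i : ι)
    (hl : (l.map (simpleReflection A)).prod (simpleRoot i) ≤ 0) :
    ∃ l' : List ι, l' ⊆ l ∧ l'.length + 1 = l.length ∧
      (l'.map (simpleReflection A)).prod =
        (l.map (simpleReflection A)).prod * simpleReflection A i := by
  induction l with
  | nil => exact (not_simpleRoot_nonpos i hl).elim
  | cons k l ih =>
    set w := (l.map (simpleReflection A)).prod with hw
    have hmem : w ∈ parabolic A Set.univ :=
      mem_parabolic_iff.2 ⟨l, fun _ _ => Set.mem_univ _, rfl⟩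
    have hroot := h.apply_simpleRoot_mem hmem i
    rcases h.sign _ hroot with h0 | h0
    · have hk : w (simpleRoot i) = simpleRoot k := by
        by_contra hk
        rw [List.map_cons, List.prod_cons, Module.End.mul_apply] at hl
        exact h.ne_zero _ (h.refl k _ hroot) (le_antisymm hl (h.reflection_nonneg hroot h0 hk))
      refine ⟨l, List.subset_cons_self k l, rfl, ?_⟩
      rw [List.map_cons, List.prod_cons, mul_assoc, ← hw,
        h.mul_reflection_of_apply hmem (one_mul 1) (by rw [hk, one_smul]), ← mul_assoc,
        h.reflection_mul_self, one_mul]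
    · obtain ⟨l', hs, hlen, hprod⟩ := ih h0
      refine ⟨k :: l', List.cons_subset_cons k hs, by simp [hlen], ?_⟩
      simp only [List.map_cons, List.prod_cons, hprod, hw, mul_assoc]

theorem eq_one_of_nonneg (h : IsRootDatum A d Φ) {w : Module.End ℤ (ι → ℤ)}
    (hw : w ∈ parabolic A I) (hpos : ∀ i ∈ I, 0 ≤ w (simpleRoot i)) : w = 1 := by
  obtain ⟨l, hl, hlw⟩ := mem_parabolic_iff.1 hw
  induction hn : l.length using Nat.strong_induction_on generalizing l with
  | _ n ih =>
    rcases l.eq_nil_or_concat' with rfl | ⟨l', i, rfl⟩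
    · simpa using hlw.symm
    · have hi : i ∈ I := hl i (by simp)
      have hprod : (l'.map (simpleReflection A)).prod * simpleReflection A i = w := by
        simpa using hlw
      have hneg : (l'.map (simpleReflection A)).prod (simpleRoot i) ≤ 0 := by
        have := hpos i hi
        rw [← hprod, Module.End.mul_apply, h.reflection_simpleRoot, map_neg] at this
        exact neg_nonneg.1 this
      obtain ⟨l'', hs, hlen, hprod'⟩ := h.exists_deletion l' i hneg
      have hlt : l''.length < n := by
        simp only [List.length_append, List.length_singleton] at hn
        omega
      exact ih l''.length hlt l'' (fun j hj => hl j (by simp [hs hj])) (hprod'.trans hprod) rfl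

theorem inversions_finite (h : IsRootDatum A d Φ) (w : Module.End ℤ (ι → ℤ)) :
    (inversions Φ w).Finite :=
  h.finite.subset fun _ hv => hv.1

theorem inversions_one (h : IsRootDatum A d Φ) : inversions Φ 1 = ∅ := by
  refine Set.eq_empty_of_forall_notMem ?_
  rintro v ⟨hv, h0, hle⟩
  exact h.ne_zero v hv (le_antisymm hle h0)

theorem ncard_inversions_mul_le (h : IsRootDatum A d Φ) (w : Module.End ℤ (ι → ℤ)) (i : ι) :
    (inversions Φ (w * simpleReflection A i)).ncard ≤ (inversions Φ w).ncard + 1 := by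
  have hsub : inversions Φ (w * simpleReflection A i) ⊆
      insert (simpleRoot i) (simpleReflection A i '' inversions Φ w) := by
    rintro v ⟨hv, h0, hle⟩
    by_cases hi : v = simpleRoot i
    · exact .inl hi
    · exact .inr ⟨simpleReflection A i v, ⟨h.refl i v hv, h.reflection_nonneg hv h0 hi, hle⟩,
        h.reflection_reflection i v⟩
  refine (Set.ncard_le_ncard hsub (((h.inversions_finite w).image _).insert _)).trans ?_
  exact (Set.ncard_insert_le _ _).trans
    (Nat.add_le_add_right (Set.ncard_image_le (h.inversions_finite w)) 1)

theorem ncard_inversions_lt_mul (h : IsRootDatum A d Φ) {w : Module.End ℤ (ι → ℤ)}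
    (hw : w ∈ parabolic A I) {i : ι} (hi : 0 ≤ w (simpleRoot i)) :
    (inversions Φ w).ncard < (inversions Φ (w * simpleReflection A i)).ncard := by
  have hinj : Function.Injective (simpleReflection A i) :=
    Function.LeftInverse.injective (h.reflection_reflection i)
  have hsub : insert (simpleRoot i) (simpleReflection A i '' inversions Φ w) ⊆
      inversions Φ (w * simpleReflection A i) := by
    rintro v (rfl | ⟨v, ⟨hv, h0, hle⟩, rfl⟩)
    · refine ⟨h.simple i, simpleRoot_nonneg i, ?_⟩
      rw [Module.End.mul_apply, h.reflection_simpleRoot, map_neg]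
      exact neg_nonpos.2 hi
    · refine ⟨h.refl i v hv, h.reflection_nonneg hv h0 ?_, ?_⟩
      · rintro rfl
        exact h.ne_zero _ (h.apply_simpleRoot_mem hw i) (le_antisymm hle hi)
      · rwa [Module.End.mul_apply, h.reflection_reflection]
  have hnot : simpleRoot i ∉ simpleReflection A i '' inversions Φ w := by
    rintro ⟨v, ⟨-, h0, -⟩, hvi⟩
    rw [← h.reflection_reflection i v, hvi, h.reflection_simpleRoot] at h0
    exact not_simpleRoot_nonpos i (neg_nonneg.1 h0)
  have := Set.ncard_le_ncard hsub (h.inversions_finite _)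
  rwa [Set.ncard_insert_of_notMem hnot ((h.inversions_finite w).image _),
    Set.ncard_image_of_injective _ hinj, Nat.add_one_le_iff] at this

theorem ncard_inversions_le_length (h : IsRootDatum A d Φ) (l : List ι) :
    (inversions Φ (l.map (simpleReflection A)).prod).ncard ≤ l.length := by
  induction l using List.reverseRecOn with
  | nil => simp [h.inversions_one]
  | append_singleton l i ih =>
    simp only [List.map_append, List.map_cons, List.map_nil, List.prod_append, List.prod_singleton,
      List.length_append, List.length_singleton]
    exact (h.ncard_inversions_mul_le _ i).trans (Nat.add_le_add_right ih 1)

theorem exists_word_length_le (h : IsRootDatum A d Φ) {w : Module.End ℤ (ι → ℤ)}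
    (hw : w ∈ parabolic A I) :
    ∃ l : List ι, (∀ i ∈ l, i ∈ I) ∧ (l.map (simpleReflection A)).prod = w ∧
      l.length ≤ (inversions Φ w).ncard := by
  induction hw using Submonoid.closure_induction_right with
  | one => exact ⟨[], by simp⟩
  | mul_right w hw x hx ih =>
    obtain ⟨i, hi, rfl⟩ := hx
    obtain ⟨l, hl, hprod, hlen⟩ := ih
    rcases h.sign _ (h.apply_simpleRoot_mem hw i) with h0 | h0
    · have hlt := h.ncard_inversions_lt_mul hw h0
      exact ⟨l ++ [i], by simpa [or_imp, forall_and, hi] using hl, by simp [hprod],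
        by simp; omega⟩
    · obtain ⟨l', hs, hlen', hprod'⟩ := h.exists_deletion l i (by rwa [hprod])
      have hle := h.ncard_inversions_mul_le (w * simpleReflection A i) i
      rw [mul_assoc, h.reflection_mul_self, mul_one] at hle
      exact ⟨l', fun j hj => hl j (hs hj), by rw [hprod', hprod], by omega⟩

theorem weylLength_eq_ncard_inversions (h : IsRootDatum A d Φ) {w : Module.End ℤ (ι → ℤ)}
    (hw : w ∈ parabolic A I) : weylLength A I w = (inversions Φ w).ncard := by
  obtain ⟨l, hl, hprod, hlen⟩ := h.exists_word_length_le hw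
  have hle : weylLength A I w ≤ l.length := Nat.sInf_le ⟨l, hl, rfl, hprod⟩
  refine le_antisymm (hle.trans hlen) (le_csInf ⟨_, l, hl, rfl, hprod⟩ ?_)
  rintro _ ⟨l, -, rfl, rfl⟩
  exact h.ncard_inversions_le_length l

theorem isLongest_of_negatesSimple (h : IsRootDatum A d Φ)
    {w : Module.End ℤ (ι → ℤ)} (hw : NegatesSimple A I w) : IsLongest A I w := by
  refine ⟨hw.1, fun v hv => ?_⟩
  rw [h.weylLength_eq_ncard_inversions hv, h.weylLength_eq_ncard_inversions hw.1]
  refine Set.ncard_le_ncard ?_ (h.inversions_finite w)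
  rintro u ⟨hu, h0, hle⟩
  refine ⟨hu, h0, hw.apply_nonpos h0 fun i hi => le_antisymm ?_ (h0 i)⟩
  simpa [apply_of_notMem hv u hi] using hle i

theorem exists_negatesSimple (h : IsRootDatum A d Φ) (I : Set ι) :
    ∃ w, NegatesSimple A I w := by
  have hfin : ((fun w => (inversions Φ w).ncard) '' (parabolic A I : Set _)).Finite := by
    refine (Set.finite_Iic Φ.ncard).subset ?_
    rintro _ ⟨w, -, rfl⟩
    exact Set.ncard_le_ncard (fun _ hv => hv.1) h.finite
  have hne : (parabolic A I : Set (Module.End ℤ (ι → ℤ))).Nonempty := ⟨1, one_mem _⟩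
  obtain ⟨w, hw, hmax⟩ := Set.Finite.exists_maximalFor' _ _ hfin hne
  refine ⟨w, hw, fun i hi => ?_⟩
  refine (h.sign _ (h.apply_simpleRoot_mem hw i)).resolve_left fun h0 => ?_
  have hlt := h.ncard_inversions_lt_mul hw h0
  exact hlt.not_ge (hmax (mul_mem hw (simpleReflection_mem_parabolic A hi)) hlt.le)

theorem mul_eq_one (h : IsRootDatum A d Φ) {w w' : Module.End ℤ (ι → ℤ)}
    (hw : NegatesSimple A I w) (hw' : NegatesSimple A I w') : w * w' = 1 := by
  refine h.eq_one_of_nonneg (mul_mem hw.1 hw'.1) fun i hi => ?_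
  have hneg : w (-w' (simpleRoot i)) ≤ 0 :=
    hw.apply_nonpos (neg_nonneg.2 (hw'.2 i hi)) fun k hk => by
      rw [Pi.neg_apply, apply_simpleRoot_of_notMem hw'.1 hi hk, neg_zero]
  rwa [map_neg, neg_nonpos] at hneg

theorem negatesSimple_unique (h : IsRootDatum A d Φ) {w w' : Module.End ℤ (ι → ℤ)}
    (hw : NegatesSimple A I w) (hw' : NegatesSimple A I w') : w = w' :=
  left_inv_eq_right_inv (h.mul_eq_one hw hw') (h.mul_eq_one hw' hw')

theorem exists_apply_ne_zero (h : IsRootDatum A d Φ) {w : Module.End ℤ (ι → ℤ)}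
    (hw : w ∈ parabolic A I) {i : ι} (hi : i ∈ I) : ∃ j ∈ I, w (simpleRoot i) j ≠ 0 := by
  obtain ⟨j, hj⟩ := Function.ne_iff.1 (h.ne_zero _ (h.apply_simpleRoot_mem hw i))
  exact ⟨j, by_contra fun hjI => hj (apply_simpleRoot_of_notMem hw hi hjI), hj⟩

theorem exists_apply_eq_neg (h : IsRootDatum A d Φ) {w : Module.End ℤ (ι → ℤ)}
    (hw : NegatesSimple A I w) {i : ι} (hi : i ∈ I) :
    ∃ j ∈ I, w (simpleRoot i) = -simpleRoot j := by
  have hww : ∀ v, w (w v) = v := LinearMap.congr_fun (h.mul_eq_one hw hw)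
  obtain ⟨j, hjI, hj⟩ := h.exists_apply_ne_zero hw.1 hi
  have hsum : simpleRoot i = ∑ k, (-w (simpleRoot i) k) • -w (simpleRoot k) := by
    simp_rw [neg_smul_neg, ← map_smul, ← map_sum, sum_smul_simpleRoot, hww]
  have hterm : ∀ k, 0 ≤ (-w (simpleRoot i) k) • -w (simpleRoot k) := fun k => by
    by_cases hk : k ∈ I
    · exact smul_nonneg (neg_nonneg.2 (hw.2 i hi k)) (neg_nonneg.2 (hw.2 k hk))
    · simp [apply_simpleRoot_of_notMem hw.1 hi hk]
  have hone : 1 ≤ -w (simpleRoot i) j := by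
    have : w (simpleRoot i) j ≤ 0 := hw.2 i hi j
    omega
  have h0 : 0 ≤ -w (simpleRoot j) := neg_nonneg.2 (hw.2 j hjI)
  have hle : -w (simpleRoot j) ≤ simpleRoot i := calc
    -w (simpleRoot j) ≤ (-w (simpleRoot i) j) • -w (simpleRoot j) := le_smul_of_one_le_left h0 hone
    _ ≤ _ := Finset.single_le_sum (fun k _ => hterm k) (Finset.mem_univ j)
    _ = simpleRoot i := hsum.symm
  have hne : -w (simpleRoot j) ≠ 0 := neg_ne_zero.2 (h.ne_zero _ (h.apply_simpleRoot_mem hw.1 j))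
  exact ⟨j, hjI, by rw [← eq_simpleRoot_of_le hne h0 hle, map_neg, hww]⟩

end IsRootDatum

end Roots

section Longest

variable {ι : Type*}

/-- All pairs of nodes of `C` and `D` are orthogonal. -/
def Orth (A : Matrix ι ι ℤ) (C D : Set ι) : Prop :=
  ∀ i ∈ C, ∀ j ∈ D, A i j = 0

theorem IsSymmetrizable.orth_symm {A : Matrix ι ι ℤ} {d : ι → ℤ} (h : IsSymmetrizable A d)
    {C D : Set ι} (hCD : Orth A C D) : Orth A D C := by
  intro j hj i hi
  have := h.symm i j
  rw [hCD i hi j hj, zero_mul, eq_comm, mul_eq_zero] at this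
  exact this.resolve_right (h.pos i).ne'

/-- The span of the simple roots `αᵢ`, `i ∈ C`, described by the vanishing of the other
coordinates. -/
def coordSpan (C : Set ι) : Set (ι → ℤ) :=
  {v | ∀ i, i ∉ C → v i = 0}

theorem neg_mem_coordSpan {C : Set ι} {v : ι → ℤ} (hv : v ∈ coordSpan C) :
    -v ∈ coordSpan C := fun i hi => by rw [Pi.neg_apply, hv i hi, neg_zero]

theorem simpleRoot_mem_coordSpan [DecidableEq ι] {C : Set ι} {i : ι} :
    simpleRoot i ∈ coordSpan C ↔ i ∈ C := by
  refine ⟨fun h => not_not.1 fun hi => ?_, fun hi k hk => simpleRoot_of_ne fun h => hk (h ▸ hi)⟩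
  have := h i hi
  rw [simpleRoot_self] at this
  exact one_ne_zero this

theorem coordSpan_subset_iff {C D : Set ι} : coordSpan C ⊆ coordSpan D ↔ C ⊆ D := by
  classical
  exact ⟨fun h _ hi => simpleRoot_mem_coordSpan.1 (h (simpleRoot_mem_coordSpan.2 hi)),
    fun h _ hv i hi => hv i fun hC => hi (h hC)⟩

theorem coordSpan_injective : Function.Injective (coordSpan : Set ι → Set (ι → ℤ)) := fun _ _ h =>
  (coordSpan_subset_iff.1 h.le).antisymm (coordSpan_subset_iff.1 h.ge)

theorem apply_mem_coordSpan [Finite ι] [DecidableEq ι] {C D : Set ι} {w : Module.End ℤ (ι → ℤ)}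
    (hw : ∀ i ∈ C, w (simpleRoot i) ∈ coordSpan D) {v : ι → ℤ} (hv : v ∈ coordSpan C) :
    w v ∈ coordSpan D := by
  have := Fintype.ofFinite ι
  intro k hk
  rw [← sum_smul_simpleRoot v, map_sum, Finset.sum_apply]
  refine Finset.sum_eq_zero fun i _ => ?_
  by_cases hi : i ∈ C
  · rw [map_smul, Pi.smul_apply, hw i hi k hk, smul_zero]
  · rw [hv i hi, zero_smul, map_zero, Pi.zero_apply]

theorem Orth.simpleCoroot_eq_zero [Fintype ι] {A : Matrix ι ι ℤ} {C D : Set ι} (h : Orth A C D)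
    {v : ι → ℤ} (hv : v ∈ coordSpan C) {j : ι} (hj : j ∈ D) : simpleCoroot A j v = 0 := by
  rw [simpleCoroot_apply]
  refine Finset.sum_eq_zero fun i _ => ?_
  by_cases hi : i ∈ C
  · rw [h i hi j hj, mul_zero]
  · rw [hv i hi, zero_mul]

variable [Fintype ι] [DecidableEq ι]

theorem apply_eq_self {A : Matrix ι ι ℤ} {I : Set ι} {w : Module.End ℤ (ι → ℤ)}
    (hw : w ∈ parabolic A I) {v : ι → ℤ} (hv : ∀ i ∈ I, simpleCoroot A i v = 0) : w v = v := by
  induction hw using Submonoid.closure_induction_left with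
  | one => rfl
  | mul_left x hx y _ ih =>
    obtain ⟨i, hi, rfl⟩ := hx
    rw [Module.End.mul_apply, ih, simpleReflection_apply, hv i hi, zero_smul, sub_zero]

theorem Orth.apply_eq_self {A : Matrix ι ι ℤ} {C D : Set ι} (h : Orth A C D)
    {w : Module.End ℤ (ι → ℤ)} (hw : w ∈ parabolic A D) {v : ι → ℤ} (hv : v ∈ coordSpan C) :
    w v = v :=
  Dynkin.apply_eq_self hw fun _ hj => h.simpleCoroot_eq_zero hv hj

open scoped Classical in
/-- The longest element of `W^I`; the value `1` for lack of an element which negates the `αᵢ` is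
not taken for a finite root system. -/
def longest (A : Matrix ι ι ℤ) (I : Set ι) : Module.End ℤ (ι → ℤ) :=
  if h : ∃ w, NegatesSimple A I w then h.choose else 1

open scoped Classical in
/-- The opposition involution `θ_I` of `I`, extended by the identity to the nodes outside `I`. -/
def opp (A : Matrix ι ι ℤ) (I : Set ι) (i : ι) : ι :=
  if h : ∃ j ∈ I, longest A I (simpleRoot i) = -simpleRoot j then h.choose else i

namespace IsRootDatum

variable {A : Matrix ι ι ℤ} {d : ι → ℤ} {Φ : Set (ι → ℤ)}

theorem negatesSimple_longest (h : IsRootDatum A d Φ) (I : Set ι) :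
    NegatesSimple A I (longest A I) := by
  rw [longest, dif_pos (h.exists_negatesSimple I)]
  exact (h.exists_negatesSimple I).choose_spec

theorem eq_longest (h : IsRootDatum A d Φ) {I : Set ι} {w : Module.End ℤ (ι → ℤ)}
    (hw : NegatesSimple A I w) : w = longest A I :=
  h.negatesSimple_unique hw (h.negatesSimple_longest I)

theorem longest_mem (h : IsRootDatum A d Φ) (I : Set ι) : longest A I ∈ parabolic A I :=
  (h.negatesSimple_longest I).1

theorem longest_mul_self (h : IsRootDatum A d Φ) (I : Set ι) : longest A I * longest A I = 1 :=
  h.mul_eq_one (h.negatesSimple_longest I) (h.negatesSimple_longest I)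

theorem longest_involutive (h : IsRootDatum A d Φ) (I : Set ι) :
    Function.Involutive (longest A I) :=
  LinearMap.congr_fun (h.longest_mul_self I)

section Opp

variable {I J : Set ι} {i j : ι}

theorem opp_spec (h : IsRootDatum A d Φ) (hi : i ∈ I) :
    opp A I i ∈ I ∧ longest A I (simpleRoot i) = -simpleRoot (opp A I i) := by
  have hex := h.exists_apply_eq_neg (h.negatesSimple_longest I) hi
  rw [opp, dif_pos hex]
  exact hex.choose_spec

theorem opp_mem (h : IsRootDatum A d Φ) (hi : i ∈ I) : opp A I i ∈ I :=
  (h.opp_spec hi).1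

theorem longest_simpleRoot (h : IsRootDatum A d Φ) (hi : i ∈ I) :
    longest A I (simpleRoot i) = -simpleRoot (opp A I i) :=
  (h.opp_spec hi).2

theorem opp_eq_iff (h : IsRootDatum A d Φ) (hi : i ∈ I) :
    opp A I i = j ↔ longest A I (simpleRoot i) = -simpleRoot j := by
  rw [h.longest_simpleRoot hi, neg_inj, simpleRoot_injective.eq_iff]

theorem opp_opp (h : IsRootDatum A d Φ) (hi : i ∈ I) : opp A I (opp A I i) = i := by
  rw [h.opp_eq_iff (h.opp_mem hi), ← neg_eq_iff_eq_neg, ← map_neg, ← h.longest_simpleRoot hi,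
    h.longest_involutive I _]

theorem symmetrizer_opp (h : IsRootDatum A d Φ) (hi : i ∈ I) : d (opp A I i) = d i := by
  have := h.form_apply_apply (h.longest_mem I) (simpleRoot i) (simpleRoot i)
  simp only [h.longest_simpleRoot hi, map_neg, LinearMap.neg_apply, form_simpleRoot_right,
    simpleCoroot_simpleRoot, h.diag] at this
  linarith

theorem cartan_opp (h : IsRootDatum A d Φ) (hi : i ∈ I) (hj : j ∈ I) :
    A (opp A I i) (opp A I j) = A i j := by
  have := h.form_apply_apply (h.longest_mem I) (simpleRoot i) (simpleRoot j)
  simp only [h.longest_simpleRoot hi, h.longest_simpleRoot hj, map_neg, LinearMap.neg_apply,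
    form_simpleRoot_right, simpleCoroot_simpleRoot, neg_neg, h.symmetrizer_opp hj] at this
  exact mul_left_cancel₀ (h.pos j).ne' this

theorem opp_image_subset (h : IsRootDatum A d Φ) (hJ : J ⊆ I) : opp A I '' J ⊆ I := by
  rintro _ ⟨j, hj, rfl⟩
  exact h.opp_mem (hJ hj)

theorem opp_image_opp_image (h : IsRootDatum A d Φ) (hJ : J ⊆ I) :
    opp A I '' (opp A I '' J) = J := by
  rw [Set.image_image]
  exact (Set.image_congr fun j hj => h.opp_opp (hJ hj)).trans (Set.image_id' J)

theorem opp_image_self (h : IsRootDatum A d Φ) (I : Set ι) : opp A I '' I = I :=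
  (h.opp_image_subset subset_rfl).antisymm fun i hi => ⟨opp A I i, h.opp_mem hi, h.opp_opp hi⟩

theorem isTheta_apply (h : IsRootDatum A d Φ) {θ : Equiv.Perm I} (hθ : IsTheta A I θ) (i : I) :
    (θ i : ι) = opp A I i := by
  obtain ⟨w, ⟨hw, -⟩, hwθ⟩ := hθ.longest
  have hwi : ∀ i : I, w (simpleRoot (i : ι)) = -simpleRoot (θ i : ι) := fun i => by
    rw [hwθ, neg_neg]
  have hneg : NegatesSimple A I w := ⟨hw, fun i hi => by
    rw [hwi ⟨i, hi⟩]
    exact neg_nonpos.2 (simpleRoot_nonneg _)⟩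
  exact ((h.opp_eq_iff i.2).2 (h.eq_longest hneg ▸ hwi i)).symm

theorem exists_isTheta (h : IsRootDatum A d Φ) (I : Set ι) : ∃ θ : Equiv.Perm I, IsTheta A I θ := by
  let f : I → I := fun i => ⟨opp A I i, h.opp_mem i.2⟩
  have hf : Function.Involutive f := fun i => Subtype.ext (h.opp_opp i.2)
  refine ⟨hf.toPerm, fun i j => h.cartan_opp i.2 j.2, longest A I,
    h.isLongest_of_negatesSimple (h.negatesSimple_longest I), fun i => ?_⟩
  rw [h.longest_simpleRoot i.2, neg_neg]
  rfl

theorem isThetaImage_iff (h : IsRootDatum A d Φ) (hJ : J ⊆ I) {K : Set ι} :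
    IsThetaImage A I J K ↔ K = opp A I '' J := by
  have himage : ∀ θ : Equiv.Perm I, IsTheta A I θ →
      {k | ∃ i : I, (i : ι) ∈ J ∧ (θ i : ι) = k} = opp A I '' J := by
    intro θ hθ
    ext k
    constructor
    · rintro ⟨i, hi, rfl⟩
      exact ⟨i, hi, (h.isTheta_apply hθ i).symm⟩
    · rintro ⟨i, hi, rfl⟩
      exact ⟨⟨i, hJ hi⟩, hi, h.isTheta_apply hθ _⟩
  constructor
  · rintro ⟨θ, hθ, rfl⟩
    exact himage θ hθ
  · rintro rfl
    obtain ⟨θ, hθ⟩ := h.exists_isTheta I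
    exact ⟨θ, hθ, (himage θ hθ).symm⟩

theorem conj_longest_mem_parabolic (h : IsRootDatum A d Φ) (hJ : J ⊆ I)
    {w : Module.End ℤ (ι → ℤ)} (hw : w ∈ parabolic A J) :
    longest A I * w * longest A I ∈ parabolic A (opp A I '' J) := by
  induction hw using Submonoid.closure_induction_left with
  | one =>
    rw [mul_one, h.longest_mul_self]
    exact one_mem _
  | mul_left x hx y _ ih =>
    obtain ⟨j, hj, rfl⟩ := hx
    rw [← mul_assoc, h.mul_reflection_of_apply (h.longest_mem I) (neg_one_mul (-1))
      (by rw [h.longest_simpleRoot (hJ hj), neg_one_smul]), mul_assoc, mul_assoc,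
      ← mul_assoc (longest A I)]
    exact mul_mem (simpleReflection_mem_parabolic A ⟨j, hj, rfl⟩) ih

theorem longest_mul_longest (h : IsRootDatum A d Φ) (hJ : J ⊆ I) :
    longest A I * longest A J = longest A (opp A I '' J) * longest A I := by
  have hneg : NegatesSimple A (opp A I '' J) (longest A I * longest A J * longest A I) := by
    refine ⟨h.conj_longest_mem_parabolic hJ (h.longest_mem J), ?_⟩
    rintro _ ⟨j, hj, rfl⟩
    rw [Module.End.mul_apply, Module.End.mul_apply, h.longest_simpleRoot (h.opp_mem (hJ hj)),
      h.opp_opp (hJ hj), map_neg, h.longest_simpleRoot hj, neg_neg,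
      h.longest_simpleRoot (hJ (h.opp_mem hj))]
    exact neg_nonpos.2 (simpleRoot_nonneg _)
  rw [← h.eq_longest hneg, mul_assoc _ (longest A I), h.longest_mul_self, mul_one]

theorem image_longest_coordSpan_subset (h : IsRootDatum A d Φ) (hJ : J ⊆ I) :
    longest A I '' coordSpan J ⊆ coordSpan (opp A I '' J) := by
  rintro _ ⟨v, hv, rfl⟩
  refine apply_mem_coordSpan (fun i hi => ?_) hv
  rw [h.longest_simpleRoot (hJ hi)]
  exact neg_mem_coordSpan (simpleRoot_mem_coordSpan.2 ⟨i, hi, rfl⟩)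

theorem image_longest_coordSpan (h : IsRootDatum A d Φ) (hJ : J ⊆ I) :
    longest A I '' coordSpan J = coordSpan (opp A I '' J) := by
  refine (h.image_longest_coordSpan_subset hJ).antisymm fun v hv =>
    ⟨longest A I v, ?_, h.longest_involutive I v⟩
  have := h.image_longest_coordSpan_subset (h.opp_image_subset hJ) ⟨v, hv, rfl⟩
  rwa [h.opp_image_opp_image hJ] at this

end Opp

section Union

variable {C D : Set ι}

theorem longest_union (h : IsRootDatum A d Φ) (hCD : Orth A C D) :
    longest A (C ∪ D) = longest A C * longest A D := by
  refine (h.eq_longest ⟨mul_mem (parabolic_mono A Set.subset_union_left (h.longest_mem C))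
    (parabolic_mono A Set.subset_union_right (h.longest_mem D)), ?_⟩).symm
  rintro i (hi | hi)
  · rw [Module.End.mul_apply,
      hCD.apply_eq_self (h.longest_mem D) (simpleRoot_mem_coordSpan.2 hi)]
    exact (h.negatesSimple_longest C).2 i hi
  · rw [Module.End.mul_apply, h.longest_simpleRoot hi, map_neg, (h.orth_symm hCD).apply_eq_self
      (h.longest_mem C) (simpleRoot_mem_coordSpan.2 (h.opp_mem hi))]
    exact neg_nonpos.2 (simpleRoot_nonneg _)

theorem opp_union (h : IsRootDatum A d Φ) (hCD : Orth A C D) {i : ι} (hi : i ∈ C) :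
    opp A (C ∪ D) i = opp A C i := by
  rw [h.opp_eq_iff (Or.inl hi), h.longest_union hCD, Module.End.mul_apply,
    hCD.apply_eq_self (h.longest_mem D) (simpleRoot_mem_coordSpan.2 hi), h.longest_simpleRoot hi]

theorem longest_commute (h : IsRootDatum A d Φ) (hCD : Orth A C D) :
    Commute (longest A C) (longest A D) := by
  rw [Commute, SemiconjBy, ← h.longest_union hCD, Set.union_comm, h.longest_union (h.orth_symm hCD)]

end Union

end IsRootDatum

end Longest

/-! ### Connected subdiagrams -/

section Connected

variable {ι κ : Type*} {A : Matrix ι ι ℤ} {d : ι → ℤ} {B : Matrix κ κ ℤ} {e : κ → ℤ}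

namespace IsSymmetrizable

theorem ne_of_orth (h : IsSymmetrizable A d) {i j : ι} (hij : A i j = 0) : i ≠ j := by
  rintro rfl
  exact two_ne_zero ((h.diag i).symm.trans hij)

theorem not_orth_of_mem (h : IsSymmetrizable A d) {C D : Set ι} {i : ι} (hC : i ∈ C)
    (hD : i ∈ D) : ¬ Orth A C D := fun hO => h.ne_of_orth (hO i hC i hD) rfl

theorem isConn_iff (h : IsSymmetrizable A d) {S : Set ι} :
    IsConn A S ↔ S.Nonempty ∧ ∀ P ⊆ S, P.Nonempty → Orth A P (S \ P) → P = S := by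
  constructor
  · intro hS
    refine ⟨Set.nonempty_coe_sort.1 hS.nonempty, fun P hP ⟨x, hx⟩ hO => ?_⟩
    have hmem : ∀ z : S, Relation.ReflTransGen ((graph A).induce S).Adj ⟨x, hP hx⟩ z → z.1 ∈ P := by
      intro z hz
      induction hz with
      | refl => exact hx
      | @tail b c _ hbc ih =>
        by_contra hc
        have hbc0 := hO b ih c ⟨c.2, hc⟩
        have hcb0 := h.orth_symm hO c ⟨c.2, hc⟩ b ih
        simp [graph, hbc0, hcb0] at hbc
    exact hP.antisymm fun y hy => hmem ⟨y, hy⟩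
      ((SimpleGraph.reachable_iff_reflTransGen _ _).1 (hS.preconnected ⟨x, hP hx⟩ ⟨y, hy⟩))
  · rintro ⟨hne, hP⟩
    have := hne.to_subtype
    refine ⟨fun ⟨x, hx⟩ ⟨y, hy⟩ => ?_⟩
    have hreach : {z | ∃ hz : z ∈ S, ((graph A).induce S).Reachable ⟨x, hx⟩ ⟨z, hz⟩} = S := by
      refine hP _ (fun z hz => hz.1) ⟨x, hx, SimpleGraph.Reachable.refl _⟩ ?_
      rintro i ⟨hi, hr⟩ j ⟨hj, hnr⟩
      by_contra hij
      have hne : i ≠ j := by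
        rintro rfl
        exact hnr ⟨hj, hr⟩
      refine hnr ⟨hj, hr.trans (SimpleGraph.Adj.reachable ?_)⟩
      simp [graph, hne, hij]
    exact (hreach.ge hy).2

theorem isConn_singleton (h : IsSymmetrizable A d) (i : ι) : IsConn A {i} :=
  h.isConn_iff.2 ⟨Set.singleton_nonempty i, fun _ hP hne _ =>
    (Set.subset_singleton_iff_eq.1 hP).resolve_left hne.ne_empty⟩

theorem disjoint_or_subset_of_isConn (h : IsSymmetrizable A d) {E P T : Set ι} (hE : IsConn A E)
    (hET : E ⊆ T) (hO : Orth A P (T \ P)) : Disjoint P E ∨ E ⊆ P := by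
  refine or_iff_not_imp_left.2 fun hd => ?_
  have hPE := (h.isConn_iff.1 hE).2 (P ∩ E) Set.inter_subset_right
    (Set.not_disjoint_iff_nonempty_inter.1 hd) fun i hi j hj =>
      hO i hi.1 j ⟨hET hj.1, fun hjP => hj.2 ⟨hjP, hj.1⟩⟩
  exact hPE.ge.trans Set.inter_subset_left

theorem isConn_union (h : IsSymmetrizable A d) {C D : Set ι} (hC : IsConn A C) (hD : IsConn A D)
    (hCD : ¬ Orth A C D) : IsConn A (C ∪ D) := by
  refine h.isConn_iff.2 ⟨(h.isConn_iff.1 hC).1.mono Set.subset_union_left, fun P hP hne hO => ?_⟩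
  rcases h.disjoint_or_subset_of_isConn hC Set.subset_union_left hO with hPC | hCP <;>
    rcases h.disjoint_or_subset_of_isConn hD Set.subset_union_right hO with hPD | hDP
  · obtain ⟨x, hx⟩ := hne
    exact ((hP hx).elim (hPC.notMem_of_mem_left hx) (hPD.notMem_of_mem_left hx)).elim
  · exact (hCD (h.orth_symm fun i hi j hj =>
      hO i (hDP hi) j ⟨.inl hj, hPC.notMem_of_mem_right hj⟩)).elim
  · exact (hCD fun i hi j hj => hO i (hCP hi) j ⟨.inr hj, hPD.notMem_of_mem_right hj⟩).elim
  · exact hP.antisymm (Set.union_subset hCP hDP)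

theorem not_isConn_union_iff (h : IsSymmetrizable A d) {C D : Set ι} (hC : IsConn A C)
    (hD : IsConn A D) : ¬ IsConn A (C ∪ D) ↔ Orth A C D := by
  refine ⟨fun hn => by_contra fun hO => hn (h.isConn_union hC hD hO), fun hO hn => ?_⟩
  have hC' := (h.isConn_iff.1 hn).2 C Set.subset_union_left (h.isConn_iff.1 hC).1
    fun i hi j hj => hO i hi j (hj.1.resolve_left hj.2)
  obtain ⟨x, hx⟩ := (h.isConn_iff.1 hD).1
  exact h.not_orth_of_mem (hC'.ge (.inr hx)) hx hO

theorem isConn_image (h : IsSymmetrizable A d) (h' : IsSymmetrizable B e) (f : ι → κ) {C : Set ι}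
    (hC : IsConn A C) (hf : ∀ i ∈ C, ∀ j ∈ C, B (f i) (f j) = 0 → A i j = 0) :
    IsConn B (f '' C) := by
  rw [h.isConn_iff] at hC
  refine h'.isConn_iff.2 ⟨hC.1.image f, fun P hP ⟨x, hx⟩ hO => ?_⟩
  obtain ⟨i, hi, rfl⟩ := hP hx
  have hCP := hC.2 (C ∩ f ⁻¹' P) Set.inter_subset_left ⟨i, hi, hx⟩ fun i hi j hj =>
    hf i hi.1 j hj.1 (hO _ hi.2 _ ⟨⟨j, hj.1, rfl⟩, fun hjP => hj.2 ⟨hj.1, hjP⟩⟩)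
  refine hP.antisymm ?_
  rintro _ ⟨j, hj, rfl⟩
  exact (hCP.ge hj).2

end IsSymmetrizable

theorem ConnSub.nonempty (C : ConnSub A) : C.1.Nonempty :=
  Set.nonempty_coe_sort.1 C.2.nonempty

section Components

variable [Finite ι] {S : Set ι} {C D : ConnSub A}

theorem subset_of_mem_components (hC : C ∈ components A S) : C.1 ⊆ S :=
  (mem_components.1 hC).1

theorem exists_component_superset (hD : D.1 ⊆ S) : ∃ C ∈ components A S, D.1 ⊆ C.1 := by
  obtain ⟨C, hDC, hC⟩ := (Set.toFinite {C : ConnSub A | C.1 ⊆ S}).exists_le_maximal hD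
  exact ⟨C, mem_components.2 hC, hDC⟩

namespace IsSymmetrizable

theorem subset_component (h : IsSymmetrizable A d) (hC : C ∈ components A S) (hD : D.1 ⊆ S)
    (hCD : ¬ Orth A C.1 D.1) : D.1 ⊆ C.1 := by
  have hC' := mem_components.1 hC
  exact Set.subset_union_right.trans (hC'.2 (y := ⟨C.1 ∪ D.1, h.isConn_union C.2 D.2 hCD⟩)
    (Set.union_subset hC'.1 hD) (Set.subset_union_left (t := D.1)))

theorem exists_mem_component (h : IsSymmetrizable A d) {i : ι} (hi : i ∈ S) :
    ∃ C ∈ components A S, i ∈ C.1 := by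
  obtain ⟨C, hC, hiC⟩ := exists_component_superset (D := ⟨{i}, h.isConn_singleton i⟩)
    (Set.singleton_subset_iff.2 hi)
  exact ⟨C, hC, hiC rfl⟩

theorem orth_component (h : IsSymmetrizable A d) (hC : C ∈ components A S) :
    Orth A C.1 (S \ C.1) := by
  intro i hi j hj
  by_contra hij
  exact hj.2 (h.subset_component hC (D := ⟨{j}, h.isConn_singleton j⟩)
    (Set.singleton_subset_iff.2 hj.1) (fun hO => hij (hO i hi j rfl)) rfl)

theorem orth_components (h : IsSymmetrizable A d) (hC : C ∈ components A S)
    (hD : D ∈ components A S) (hne : C ≠ D) : Orth A C.1 D.1 :=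
  (h.not_isConn_union_iff C.2 D.2).1 (not_isConn_union hC hD hne)

end IsSymmetrizable

end Components

variable [Fintype ι] [DecidableEq ι] {Φ : Set (ι → ℤ)}

open scoped Classical in
/-- The subdiagram `θ_I(J)` for `J ⊆ I`. The other subdiagrams are left unchanged, so that `oppSub`
is an involution of all of them. -/
def oppSub (A : Matrix ι ι ℤ) (I : Set ι) (J : ConnSub A) : ConnSub A :=
  if h : J.1 ⊆ I ∧ IsConn A (opp A I '' J.1) then ⟨opp A I '' J.1, h.2⟩ else J

namespace IsRootDatum

theorem isConn_opp_image (h : IsRootDatum A d Φ) {I J : Set ι} (hJ : J ⊆ I) (hc : IsConn A J) :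
    IsConn A (opp A I '' J) :=
  h.isConn_image h.toIsSymmetrizable _ hc fun i hi j hj hij => by
    rwa [h.cartan_opp (hJ hi) (hJ hj)] at hij

theorem coe_oppSub (h : IsRootDatum A d Φ) {I : Set ι} {J : ConnSub A} (hJ : J.1 ⊆ I) :
    (oppSub A I J).1 = opp A I '' J.1 := by
  rw [oppSub, dif_pos ⟨hJ, h.isConn_opp_image hJ J.2⟩]

theorem oppSub_subset_iff (h : IsRootDatum A d Φ) {I : Set ι} {J : ConnSub A} :
    (oppSub A I J).1 ⊆ I ↔ J.1 ⊆ I := by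
  refine ⟨fun hI => ?_, fun hJ => h.coe_oppSub hJ ▸ h.opp_image_subset hJ⟩
  by_contra hJ
  rw [oppSub, dif_neg fun hc => hJ hc.1] at hI
  exact hJ hI

theorem oppSub_involutive (h : IsRootDatum A d Φ) (I : Set ι) :
    Function.Involutive (oppSub A I) := by
  intro J
  by_cases hJ : J.1 ⊆ I
  · exact Subtype.ext (by
      rw [h.coe_oppSub (h.oppSub_subset_iff.2 hJ), h.coe_oppSub hJ, h.opp_image_opp_image hJ])
  · have hfix : oppSub A I J = J := dif_neg fun hc => hJ hc.1
    rw [hfix, hfix]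

theorem oppSub_mono (h : IsRootDatum A d Φ) {I : Set ι} {J K : ConnSub A} (hK : K.1 ⊆ I)
    (hJK : J.1 ⊆ K.1) : (oppSub A I J).1 ⊆ (oppSub A I K).1 := by
  rw [h.coe_oppSub hK, h.coe_oppSub (hJK.trans hK)]
  exact Set.image_mono hJK

section Components

variable {S : Set ι} {C : ConnSub A}

theorem opp_component (h : IsRootDatum A d Φ) (hC : C ∈ components A S) {i : ι} (hi : i ∈ C.1) :
    opp A S i = opp A C.1 i := by
  have := h.opp_union (h.orth_component hC) hi
  rwa [Set.union_sdiff_cancel (subset_of_mem_components hC)] at this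

theorem oppSub_component (h : IsRootDatum A d Φ) (hC : C ∈ components A S) {J : ConnSub A}
    (hJ : J.1 ⊆ C.1) : oppSub A S J = oppSub A C.1 J :=
  Subtype.ext (by
    rw [h.coe_oppSub hJ, h.coe_oppSub (hJ.trans (subset_of_mem_components hC))]
    exact Set.image_congr fun _ hi => h.opp_component hC (hJ hi))

theorem oppSub_mem_components_of_mem (h : IsRootDatum A d Φ) {I J : Set ι} (hJ : J ⊆ I)
    {D : ConnSub A} (hD : D ∈ components A J) : oppSub A I D ∈ components A (opp A I '' J) := by
  have hDI : D.1 ⊆ I := (subset_of_mem_components hD).trans hJ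
  have hDJ : (oppSub A I D).1 ⊆ opp A I '' J := by
    rw [h.coe_oppSub hDI]
    exact Set.image_mono (subset_of_mem_components hD)
  refine mem_components.2 ⟨hDJ, fun E hE hDE => ?_⟩
  have hEI : E.1 ⊆ I := hE.trans (h.opp_image_subset hJ)
  have hEJ : (oppSub A I E).1 ⊆ J := by
    rw [h.coe_oppSub hEI, ← h.opp_image_opp_image hJ]
    exact Set.image_mono hE
  have hDE' : D.1 ⊆ (oppSub A I E).1 := by
    rw [← h.oppSub_involutive I D]
    exact h.oppSub_mono hEI hDE
  have hED := h.oppSub_mono hDI ((mem_components.1 hD).2 hEJ hDE')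
  rwa [h.oppSub_involutive] at hED

theorem oppSub_mem_components_iff (h : IsRootDatum A d Φ) {I J : Set ι} (hJ : J ⊆ I)
    {D : ConnSub A} : oppSub A I D ∈ components A (opp A I '' J) ↔ D ∈ components A J := by
  refine ⟨fun hD => ?_, h.oppSub_mem_components_of_mem hJ⟩
  have := h.oppSub_mem_components_of_mem (h.opp_image_subset hJ) hD
  rwa [h.oppSub_involutive, h.opp_image_opp_image hJ] at this

end Components

end IsRootDatum

end Connected

/-! ### Simply laced diagrams -/

section SimplyLaced

variable {κ : Type*} [Fintype κ] {B : Matrix κ κ ℤ}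

theorem prod_simpleReflection_apply [DecidableEq κ] {l : List κ}
    (hl : l.Pairwise fun z y => B y z = 0) (v : κ → ℤ) : (l.map (simpleReflection B)).prod v =
      v - (l.map fun z => simpleCoroot B z v • simpleRoot z).sum := by
  induction l with
  | nil => simp
  | cons z l ih =>
    rw [List.pairwise_cons] at hl
    have hz : simpleCoroot B z (l.map fun y => simpleCoroot B y v • simpleRoot y).sum = 0 := by
      rw [map_list_sum, List.map_map]
      refine List.sum_eq_zero fun a ha => ?_
      obtain ⟨y, hy, rfl⟩ := List.mem_map.1 ha
      rw [Function.comp_apply, map_smul, simpleCoroot_simpleRoot, hl.1 y hy, smul_zero]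
    rw [List.map_cons, List.prod_cons, Module.End.mul_apply, simpleReflection_apply, ih hl.2,
      map_sub, hz, sub_zero, List.map_cons, List.sum_cons]
    abel

/-- Symmetric generalized Cartan matrices of finite type, that is, the Cartan matrices of the simply
laced Dynkin diagrams. -/
structure IsFiniteSymmetric (B : Matrix κ κ ℤ) : Prop where
  diag : ∀ y, B y y = 2
  symm : ∀ y z, B y z = B z y
  nonpos : ∀ y z, y ≠ z → B y z ≤ 0
  pos : ∀ v, v ≠ 0 → 0 < form B 1 v v

/-- The vectors of squared length `2`, which are the roots of a simply laced diagram. -/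
def shortVectors (B : Matrix κ κ ℤ) : Set (κ → ℤ) := {v | form B 1 v v = 2}

namespace IsFiniteSymmetric

theorem isSymmetrizable (h : IsFiniteSymmetric B) : IsSymmetrizable B 1 where
  diag := h.diag
  pos _ := zero_lt_one
  symm y z := by rw [h.symm]; rfl

theorem form_smul_simpleRoot [DecidableEq κ] (h : IsFiniteSymmetric B) (a b : ℤ) (y : κ) :
    form B 1 (a • simpleRoot y) (b • simpleRoot y) = 2 * (a * b) := by
  simp only [map_smul, LinearMap.smul_apply, form_simpleRoot_right, simpleCoroot_simpleRoot, h.diag,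
    smul_eq_mul, Pi.one_apply]
  ring

theorem even_form (h : IsFiniteSymmetric B) (v : κ → ℤ) : Even (form B 1 v v) := by
  classical
  rw [← sum_smul_simpleRoot v]
  refine Finset.sum_induction _ (fun v => Even (form B 1 v v)) ?_ (by simp) fun y _ => ?_
  · intro u v hu hv
    simp only [map_add, LinearMap.add_apply, h.isSymmetrizable.form_comm v u]
    obtain ⟨a, ha⟩ := hu
    obtain ⟨b, hb⟩ := hv
    exact ⟨a + b + form B 1 u v, by rw [ha, hb]; ring⟩
  · rw [h.form_smul_simpleRoot]
    exact even_two_mul _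

theorem two_le_form (h : IsFiniteSymmetric B) {v : κ → ℤ} (hv : v ≠ 0) : 2 ≤ form B 1 v v := by
  obtain ⟨k, hk⟩ := h.even_form v
  have := h.pos v hv
  omega

theorem form_nonneg (h : IsFiniteSymmetric B) (v : κ → ℤ) : 0 ≤ form B 1 v v := by
  by_cases hv : v = 0
  · simp [hv]
  · exact (h.pos v hv).le

theorem form_posPart_negPart (h : IsFiniteSymmetric B) (v : κ → ℤ) : form B 1 v⁺ v⁻ ≤ 0 := by
  rw [form_apply]
  refine Finset.sum_nonpos fun z _ => ?_
  rw [simpleCoroot_apply, Pi.one_apply, one_mul, Finset.sum_mul]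
  refine Finset.sum_nonpos fun y _ => ?_
  by_cases hyz : y = z
  · subst hyz
    have hzero : v⁺ y * v⁻ y = 0 := by
      rw [Pi.posPart_apply, Pi.negPart_apply, mul_eq_zero, posPart_eq_zero, negPart_eq_zero]
      exact le_total _ _
    rw [mul_right_comm, hzero, zero_mul]
  · exact mul_nonpos_of_nonpos_of_nonneg
      (mul_nonpos_of_nonneg_of_nonpos (posPart_nonneg v y) (h.nonpos y z hyz)) (negPart_nonneg v z)

theorem eq_zero_of_simpleCoroot_eq_zero (h : IsFiniteSymmetric B) {v : κ → ℤ}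
    (hv : ∀ z, simpleCoroot B z v = 0) : v = 0 := by
  by_contra hne
  refine (h.pos v hne).ne' ?_
  rw [form_apply]
  exact Finset.sum_eq_zero fun z _ => by rw [hv, zero_mul, mul_zero]

theorem simpleCoroot_mem_Icc (h : IsFiniteSymmetric B) {v : κ → ℤ} (hv : v ∈ shortVectors B)
    (z : κ) : simpleCoroot B z v ∈ Set.Icc (-2) 2 := by
  classical
  have hv2 : form B 1 v v = 2 := hv
  have hsub := h.form_nonneg (v - simpleRoot z)
  have hadd := h.form_nonneg (v + simpleRoot z)
  simp only [map_sub, map_add, LinearMap.sub_apply, LinearMap.add_apply, form_simpleRoot_right,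
    h.isSymmetrizable.form_simpleRoot_left, simpleCoroot_simpleRoot, h.diag, hv2,
    Pi.one_apply] at hsub hadd
  constructor <;> omega

theorem shortVectors_finite (h : IsFiniteSymmetric B) : (shortVectors B).Finite := by
  classical
  let f : (κ → ℤ) →ₗ[ℤ] (κ → ℤ) := LinearMap.pi (simpleCoroot B)
  have hf : Function.Injective f := (injective_iff_map_eq_zero f).2 fun v hv =>
    h.eq_zero_of_simpleCoroot_eq_zero fun z => congrFun hv z
  refine ((Set.finite_Icc (fun _ => -2 : κ → ℤ) fun _ => 2).preimage hf.injOn).subset ?_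
  exact fun v hv => ⟨fun z => (h.simpleCoroot_mem_Icc hv z).1,
    fun z => (h.simpleCoroot_mem_Icc hv z).2⟩

theorem isRootDatum [DecidableEq κ] (h : IsFiniteSymmetric B) :
    IsRootDatum B 1 (shortVectors B) where
  toIsSymmetrizable := h.isSymmetrizable
  finite := h.shortVectors_finite
  simple y := by
    have := h.form_smul_simpleRoot 1 1 y
    rwa [one_smul] at this
  refl y v hv := (h.isSymmetrizable.form_simpleReflection y v v).trans hv
  ne_zero v hv hz := by
    rw [hz, shortVectors, Set.mem_ofPred_eq, map_zero] at hv
    exact absurd hv (by simp)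
  sign v hv := by
    rw [← negPart_eq_zero, ← posPart_eq_zero]
    by_contra! hne
    -- Otherwise `(v, v) ≥ (v⁺, v⁺) + (v⁻, v⁻) ≥ 4`.
    have hpos := h.two_le_form hne.2
    have hneg := h.two_le_form hne.1
    have hcross := h.form_posPart_negPart v
    have hform : form B 1 v v = 2 := hv
    rw [← posPart_sub_negPart v] at hform
    simp only [map_sub, LinearMap.sub_apply, h.isSymmetrizable.form_comm v⁻ v⁺] at hform
    linarith
  reduced v hv y hy := by
    have hform : form B 1 v v = 2 := hv
    have hsmul : v = v y • simpleRoot y := by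
      ext z
      by_cases hz : z = y
      · simp [hz, simpleRoot]
      · simp [hz, simpleRoot, hy z hz]
    rw [hsmul, h.form_smul_simpleRoot] at hform
    nlinarith

end IsFiniteSymmetric

end SimplyLaced

/-! ### Folding of root systems -/

namespace Folding

variable {X Y : Type*} [Fintype Y] {A : Matrix X X ℤ} {B : Matrix Y Y ℤ} (F : Folding A B)

/-- The map from `Y` to `X` whose fibres are the orbits `σ(i)`. -/
def proj (y : Y) : X := F.σ.symm (Quotient.mk _ y)

theorem σ_eq_iff (i : X) (y : Y) : F.σ i = Quotient.mk _ y ↔ F.proj y = i := by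
  rw [proj, Equiv.symm_apply_eq, eq_comm]

theorem mem_image {I : Set X} {y : Y} : y ∈ F.image I ↔ F.proj y ∈ I := by
  simp [image, σ_eq_iff]

theorem proj_surjective : Function.Surjective F.proj := by
  intro i
  obtain ⟨y, hy⟩ := Quotient.exists_rep (F.σ i)
  exact ⟨y, (F.σ_eq_iff i y).1 hy.symm⟩

theorem image_mono {I J : Set X} (h : I ⊆ J) : F.image I ⊆ F.image J := fun _ hy =>
  F.mem_image.2 (h (F.mem_image.1 hy))

theorem image_injective : Function.Injective F.image := by
  intro I J h
  ext i
  obtain ⟨y, rfl⟩ := F.proj_surjective i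
  rw [← F.mem_image, h, F.mem_image]

/-- The orbit `σ(i)`. -/
def fibre [DecidableEq X] (i : X) : Finset Y := Finset.univ.filter fun y => F.proj y = i

theorem mem_fibre [DecidableEq X] {i : X} {y : Y} : y ∈ F.fibre i ↔ F.proj y = i := by
  simp [fibre]

theorem fibre_nonempty [DecidableEq X] (i : X) : (F.fibre i).Nonempty :=
  (F.proj_surjective i).imp fun _ hy => F.mem_fibre.2 hy

theorem cartan_proj [DecidableEq X] (y : Y) (j : X) : A (F.proj y) j = ∑ z ∈ F.fibre j, B y z := by
  rw [F.σ_cartan _ j y ((F.σ_eq_iff _ y).2 rfl), finsum_eq_sum_of_fintype, fibre,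
    Finset.sum_filter]
  refine Finset.sum_congr rfl fun z _ => ?_
  classical
  rw [finsum_eq_if]
  exact if_congr (F.σ_eq_iff j z) rfl rfl

theorem cartan_eq_zero (hB : IsFiniteSymmetric B) (hA : ∀ i, A i i = 2) {y z : Y}
    (hyz : F.proj y = F.proj z) (hne : y ≠ z) : B y z = 0 := by
  classical
  have hsum := F.cartan_proj y (F.proj y)
  rw [hA, ← Finset.add_sum_erase _ _ (F.mem_fibre.2 rfl), hB.diag, left_eq_add,
    Finset.sum_eq_zero_iff_of_nonpos fun z hz => hB.nonpos y z (Finset.ne_of_mem_erase hz).symm]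
    at hsum
  exact hsum z (Finset.mem_erase.2 ⟨hne.symm, F.mem_fibre.2 hyz.symm⟩)

variable [DecidableEq X]

/-- The linear map of root lattices which sends `α_y` to `αᵢ` for `y ∈ σ(i)`. -/
def foldMap : (Y → ℤ) →ₗ[ℤ] (X → ℤ) :=
  LinearMap.pi fun i => ∑ y ∈ F.fibre i, LinearMap.proj y

theorem foldMap_apply (v : Y → ℤ) (i : X) : F.foldMap v i = ∑ y ∈ F.fibre i, v y := by
  simp [foldMap]

theorem foldMap_simpleRoot [DecidableEq Y] (y : Y) :
    F.foldMap (simpleRoot y) = simpleRoot (F.proj y) := by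
  ext i
  simp [foldMap_apply, simpleRoot, Pi.single_apply, mem_fibre, eq_comm]

theorem foldMap_nonneg {v : Y → ℤ} (hv : 0 ≤ v) : 0 ≤ F.foldMap v := fun i => by
  rw [foldMap_apply]
  exact Finset.sum_nonneg fun y _ => hv y

theorem foldMap_nonpos {v : Y → ℤ} (hv : v ≤ 0) : F.foldMap v ≤ 0 := fun i => by
  rw [foldMap_apply]
  exact Finset.sum_nonpos fun y _ => hv y

theorem eq_zero_of_foldMap_apply_eq_zero {v : Y → ℤ} (hv : 0 ≤ v) {y : Y}
    (h : F.foldMap v (F.proj y) = 0) : v y = 0 := by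
  rw [foldMap_apply, Finset.sum_eq_zero_iff_of_nonneg fun y _ => hv y] at h
  exact h y (F.mem_fibre.2 rfl)

theorem eq_zero_of_foldMap_eq_zero {v : Y → ℤ} (hv : 0 ≤ v) (h : F.foldMap v = 0) : v = 0 :=
  funext fun _ => F.eq_zero_of_foldMap_apply_eq_zero hv (congrFun h _)

theorem card_fibre_pos (j : X) : 0 < ((F.fibre j).card : ℤ) :=
  Int.natCast_pos.2 (F.fibre_nonempty j).card_pos

theorem card_mul_cartan (i j : X) :
    ((F.fibre i).card : ℤ) * A i j = ∑ y ∈ F.fibre i, ∑ z ∈ F.fibre j, B y z := by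
  rw [← nsmul_eq_mul, ← Finset.sum_const]
  refine Finset.sum_congr rfl fun y hy => ?_
  rw [← F.cartan_proj y j, F.mem_fibre.1 hy]

theorem card_mul_cartan_comm (hB : ∀ y z, B y z = B z y) (i j : X) :
    ((F.fibre i).card : ℤ) * A i j = (F.fibre j).card * A j i := by
  rw [card_mul_cartan, card_mul_cartan]
  exact Finset.sum_comm.trans (Finset.sum_congr rfl fun z _ =>
    Finset.sum_congr rfl fun y _ => hB y z)

theorem form_self_of_support_subset (hB : IsFiniteSymmetric B) (hA : ∀ i, A i i = 2) {v : Y → ℤ}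
    {i : X} (hv : ∀ y ∉ F.fibre i, v y = 0) : form B 1 v v = 2 * ∑ y ∈ F.fibre i, v y ^ 2 := by
  have hsub : ∀ f : Y → ℤ, (∀ y, v y = 0 → f y = 0) → ∑ y, f y = ∑ y ∈ F.fibre i, f y :=
    fun f hf => (Finset.sum_subset (Finset.subset_univ _) fun y _ hy => hf y (hv y hy)).symm
  rw [form_apply, hsub _ fun y hy => by rw [hy, mul_zero, mul_zero], Finset.mul_sum]
  refine Finset.sum_congr rfl fun z hz => ?_
  rw [simpleCoroot_apply, hsub _ fun y hy => by rw [hy, zero_mul],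
    Finset.sum_eq_single_of_mem z hz fun y hy hne => ?_, hB.diag, Pi.one_apply]
  · ring
  · rw [F.cartan_eq_zero hB hA ((F.mem_fibre.1 hy).trans (F.mem_fibre.1 hz).symm) hne, mul_zero]

theorem foldMap_le_one (hB : IsFiniteSymmetric B) (hA : ∀ i, A i i = 2) {v : Y → ℤ}
    (hv : v ∈ shortVectors B) (h0 : 0 ≤ v) {i : X} (hi : ∀ j, j ≠ i → F.foldMap v j = 0) :
    F.foldMap v i ≤ 1 := by
  have hform : form B 1 v v = 2 := hv
  rw [F.form_self_of_support_subset hB hA fun y hy =>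
    F.eq_zero_of_foldMap_apply_eq_zero h0 (hi _ fun h => hy (F.mem_fibre.2 h))] at hform
  have hle : F.foldMap v i ≤ ∑ y ∈ F.fibre i, v y ^ 2 := by
    rw [foldMap_apply]
    exact Finset.sum_le_sum fun y _ => Int.le_self_sq (v y)
  omega

variable [Fintype X]

theorem simpleCoroot_foldMap (j : X) (v : Y → ℤ) :
    simpleCoroot A j (F.foldMap v) = ∑ z ∈ F.fibre j, simpleCoroot B z v := by
  simp only [simpleCoroot_apply, foldMap_apply]
  rw [Finset.sum_comm, ← Finset.sum_fiberwise Finset.univ F.proj]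
  refine Finset.sum_congr rfl fun i _ => ?_
  rw [Finset.sum_mul]
  refine Finset.sum_congr rfl fun y hy => ?_
  rw [← F.mem_fibre.1 hy, F.cartan_proj y j, Finset.mul_sum]

/-- The symmetrizer of the folded diagram: a common multiple of the lengths of the orbits divided
by the length of `σ(j)`. -/
def weight (j : X) : ℤ := ∏ i ∈ Finset.univ.erase j, ((F.fibre i).card : ℤ)

theorem card_mul_weight (j : X) :
    ((F.fibre j).card : ℤ) * F.weight j = ∏ i, ((F.fibre i).card : ℤ) :=
  Finset.mul_prod_erase Finset.univ (fun i => ((F.fibre i).card : ℤ)) (Finset.mem_univ j)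

theorem isSymmetrizable (hB : IsFiniteSymmetric B) (hA : ∀ i, A i i = 2) :
    IsSymmetrizable A F.weight where
  diag := hA
  pos j := Finset.prod_pos fun i _ => F.card_fibre_pos i
  symm i j := by
    refine mul_left_cancel₀ (mul_pos (F.card_fibre_pos i) (F.card_fibre_pos j)).ne' ?_
    have hweight := (F.card_mul_weight i).trans (F.card_mul_weight j).symm
    linear_combination ((F.fibre j).card * F.weight j : ℤ) * F.card_mul_cartan_comm hB.symm i j -
      ((F.fibre j).card * A j i : ℤ) * hweight

theorem exists_lift_reflection [DecidableEq Y] (hB : IsFiniteSymmetric B) (hA : ∀ i, A i i = 2)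
    {I : Set X} {j : X} (hj : j ∈ I) : ∃ w ∈ parabolic B (F.image I), ∀ v,
      F.foldMap (w v) = simpleReflection A j (F.foldMap v) := by
  have hproj : ∀ y ∈ (F.fibre j).toList, F.proj y = j := fun y hy =>
    F.mem_fibre.1 (Finset.mem_toList.1 hy)
  have hpair : (F.fibre j).toList.Pairwise fun z y => B y z = 0 :=
    (Finset.nodup_toList _).imp_of_mem fun hz hy hne =>
      F.cartan_eq_zero hB hA ((hproj _ hy).trans (hproj _ hz).symm) hne.symm
  refine ⟨((F.fibre j).toList.map (simpleReflection B)).prod, mem_parabolic_iff.2 ⟨_, fun y hy =>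
    F.mem_image.2 (by rwa [hproj y hy]), rfl⟩, fun v => ?_⟩
  rw [prod_simpleReflection_apply hpair, simpleReflection_apply, Finset.sum_map_toList, map_sub,
    map_sum, simpleCoroot_foldMap, Finset.sum_smul]
  congr 1
  refine Finset.sum_congr rfl fun z hz => ?_
  rw [map_smul, foldMap_simpleRoot, F.mem_fibre.1 hz]

theorem isRootDatum (hB : IsFiniteSymmetric B) (hA : ∀ i, A i i = 2) :
    IsRootDatum A F.weight (F.foldMap '' shortVectors B) where
  toIsSymmetrizable := F.isSymmetrizable hB hA
  finite := hB.shortVectors_finite.image _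
  simple i := by
    classical
    obtain ⟨y, rfl⟩ := F.proj_surjective i
    exact ⟨simpleRoot y, hB.isRootDatum.simple y, F.foldMap_simpleRoot y⟩
  refl i := by
    classical
    rintro _ ⟨v, hv, rfl⟩
    obtain ⟨w, hw, hwv⟩ := F.exists_lift_reflection hB hA (Set.mem_univ i)
    exact ⟨w v, hB.isRootDatum.apply_mem hw hv, hwv v⟩
  ne_zero := by
    classical
    rintro _ ⟨v, hv, rfl⟩ hz
    rcases hB.isRootDatum.sign v hv with h0 | h0
    · exact hB.isRootDatum.ne_zero v hv (F.eq_zero_of_foldMap_eq_zero h0 hz)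
    · refine hB.isRootDatum.ne_zero v hv (neg_eq_zero.1 ?_)
      exact F.eq_zero_of_foldMap_eq_zero (neg_nonneg.2 h0) (by rw [map_neg, hz, neg_zero])
  sign := by
    classical
    rintro _ ⟨v, hv, rfl⟩
    exact (hB.isRootDatum.sign v hv).imp F.foldMap_nonneg F.foldMap_nonpos
  reduced := by
    classical
    rintro _ ⟨v, hv, rfl⟩ i hi
    rcases hB.isRootDatum.sign v hv with h0 | h0
    · exact F.foldMap_le_one hB hA hv h0 hi
    · exact (F.foldMap_nonpos h0 i).trans zero_le_one

variable [DecidableEq Y]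

theorem exists_lift (hB : IsFiniteSymmetric B) (hA : ∀ i, A i i = 2) {I : Set X}
    {w : Module.End ℤ (X → ℤ)} (hw : w ∈ parabolic A I) :
    ∃ w' ∈ parabolic B (F.image I), ∀ v, F.foldMap (w' v) = w (F.foldMap v) := by
  induction hw using Submonoid.closure_induction_left with
  | one => exact ⟨1, one_mem _, fun _ => rfl⟩
  | mul_left x hx y _ ih =>
    obtain ⟨j, hj, rfl⟩ := hx
    obtain ⟨u, hu, huv⟩ := ih
    obtain ⟨r, hr, hrv⟩ := F.exists_lift_reflection hB hA hj
    exact ⟨r * u, mul_mem hr hu, fun v => by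
      rw [Module.End.mul_apply, Module.End.mul_apply, hrv, huv]⟩

theorem foldMap_longest (hB : IsFiniteSymmetric B) (hA : ∀ i, A i i = 2) (I : Set X) (v : Y → ℤ) :
    F.foldMap (longest B (F.image I) v) = longest A I (F.foldMap v) := by
  obtain ⟨w, hw, hwv⟩ := F.exists_lift hB hA ((F.isRootDatum hB hA).longest_mem I)
  have hneg : NegatesSimple B (F.image I) w := by
    refine ⟨hw, fun y hy => ?_⟩
    have hroot := hB.isRootDatum.apply_mem hw (hB.isRootDatum.simple y)
    refine (hB.isRootDatum.sign _ hroot).resolve_left fun h0 => hB.isRootDatum.ne_zero _ hroot ?_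
    refine F.eq_zero_of_foldMap_eq_zero h0 (le_antisymm ?_ (F.foldMap_nonneg h0))
    rw [hwv, foldMap_simpleRoot]
    exact ((F.isRootDatum hB hA).negatesSimple_longest I).2 _ (F.mem_image.1 hy)
  rw [← hB.isRootDatum.eq_longest hneg, hwv]

theorem proj_opp (hB : IsFiniteSymmetric B) (hA : ∀ i, A i i = 2) {I : Set X} {y : Y}
    (hy : y ∈ F.image I) : F.proj (opp B (F.image I) y) = opp A I (F.proj y) := by
  have h := F.foldMap_longest hB hA I (simpleRoot y)
  rw [hB.isRootDatum.longest_simpleRoot hy, map_neg, foldMap_simpleRoot, foldMap_simpleRoot] at h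
  exact (((F.isRootDatum hB hA).opp_eq_iff (F.mem_image.1 hy)).2 h.symm).symm

theorem opp_image (hB : IsFiniteSymmetric B) (hA : ∀ i, A i i = 2) {I J : Set X} (hJ : J ⊆ I) :
    opp B (F.image I) '' F.image J = F.image (opp A I '' J) := by
  ext y
  constructor
  · rintro ⟨y, hy, rfl⟩
    rw [mem_image, F.proj_opp hB hA (F.image_mono hJ hy)]
    exact ⟨_, F.mem_image.1 hy, rfl⟩
  · intro hy
    obtain ⟨j, hj, hjy⟩ := F.mem_image.1 hy
    have hyI : y ∈ F.image I := F.mem_image.2 (by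
      rw [← hjy]
      exact (F.isRootDatum hB hA).opp_mem (hJ hj))
    refine ⟨opp B (F.image I) y, ?_, hB.isRootDatum.opp_opp hyI⟩
    rw [mem_image, F.proj_opp hB hA hyI, ← hjy, (F.isRootDatum hB hA).opp_opp (hJ hj)]
    exact hj

end Folding

/-! ### Cactus groups -/

section Cactus

variable {ι : Type*} [Fintype ι] [DecidableEq ι]
  {A : Matrix ι ι ℤ} {d : ι → ℤ} {Φ : Set (ι → ℤ)} {I J : ConnSub A} {S T : Set ι}

theorem gen_mul_self (I : ConnSub A) : gen I * gen I = 1 :=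
  PresentedGroup.one_of_mem (CactusRel.sq I)

theorem pairwise_commute_gen (A : Matrix ι ι ℤ) (S : Set ι) :
    ((components A S : Finset (ConnSub A)) : Set (ConnSub A)).Pairwise
      (Function.onFun Commute gen) :=
  fun _ hC _ hD hne => gen_comm _ _ (not_isConn_union hC hD hne)

/-- The product of the commuting generators which belong to the connected components of `S`. -/
def setGen (A : Matrix ι ι ℤ) (S : Set ι) : CactusGroup A :=
  (components A S).noncommProd gen (pairwise_commute_gen A S)

theorem setGen_eq_prod {l : List (ConnSub A)} (hl : l.Nodup)
    (hmem : ∀ C, C ∈ l ↔ C ∈ components A S) : setGen A S = (l.map gen).prod := by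
  classical
  have hS : components A S = l.toFinset := Finset.ext fun C => by rw [List.mem_toFinset, hmem]
  rw [← Finset.noncommProd_toFinset l gen (hS ▸ pairwise_commute_gen A S) hl]
  exact Finset.noncommProd_congr hS (fun _ _ => rfl) _

theorem setGen_eq_prod_toList (S : Set ι) :
    setGen A S = ((components A S).toList.map gen).prod :=
  setGen_eq_prod (Finset.nodup_toList _) fun _ => Finset.mem_toList

theorem setGen_mul_self (S : Set ι) : setGen A S * setGen A S = 1 := by
  have hc := pairwise_commute_gen A S
  refine (Finset.noncommProd_mul_distrib gen gen hc hc hc).symm.trans ?_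
  exact (Finset.noncommProd_eq_pow_card _ _ _ 1 fun C _ => gen_mul_self C).trans (one_pow _)

theorem commute_setGen {x : CactusGroup A} (hx : ∀ C ∈ components A S, Commute x (gen C)) :
    Commute x (setGen A S) :=
  Finset.noncommProd_commute _ _ _ _ hx

theorem IsSymmetrizable.commute_gen (h : IsSymmetrizable A d) (hO : Orth A I.1 J.1) :
    Commute (gen I) (gen J) :=
  gen_comm I J ((h.not_isConn_union_iff I.2 J.2).2 hO)

theorem IsSymmetrizable.setGen_comm (h : IsSymmetrizable A d) (hO : Orth A S T) :
    Commute (setGen A S) (setGen A T) :=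
  commute_setGen fun _ hD => (commute_setGen fun _ hC => (h.commute_gen fun i hi j hj =>
    hO i (subset_of_mem_components hC hi) j (subset_of_mem_components hD hj)).symm).symm

namespace IsRootDatum

theorem gen_mul_gen (h : IsRootDatum A d Φ) (hJ : J.1 ⊆ I.1) :
    gen I * gen J = gen (oppSub A I.1 J) * gen I :=
  mul_inv_eq_one.mp (PresentedGroup.one_of_mem
    (CactusRel.conj I J (oppSub A I.1 J) hJ ((h.isThetaImage_iff hJ).2 (h.coe_oppSub hJ))))

theorem setGen_mul_gen (h : IsRootDatum A d Φ) (hJ : J.1 ⊆ S) :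
    setGen A S * gen J = gen (oppSub A S J) * setGen A S := by
  classical
  obtain ⟨C, hC, hJC⟩ := exists_component_superset hJ
  have hcomm := pairwise_commute_gen A S
  have hcomm' := hcomm.mono (Finset.coe_subset.2 ((components A S).erase_subset C))
  have hprod : setGen A S = gen C * ((components A S).erase C).noncommProd gen hcomm' :=
    (Finset.mul_noncommProd_erase _ hC gen hcomm _).symm
  have hrest : Commute (gen J) (((components A S).erase C).noncommProd gen hcomm') :=
    Finset.noncommProd_commute _ _ _ _ fun D hD => h.commute_gen fun i hi j hj =>
      h.orth_components hC (Finset.mem_of_mem_erase hD) (Finset.ne_of_mem_erase hD).symm i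
        (hJC hi) j hj
  rw [hprod, h.oppSub_component hC hJC, mul_assoc, ← hrest.eq, ← mul_assoc, h.gen_mul_gen hJC,
    mul_assoc]

theorem setGen_mul_setGen (h : IsRootDatum A d Φ) (hT : T ⊆ S) :
    setGen A S * setGen A T = setGen A (opp A S '' T) * setGen A S := by
  have hT' : setGen A (opp A S '' T) =
      (((components A T).toList.map (oppSub A S)).map gen).prod := by
    refine setGen_eq_prod
      ((Finset.nodup_toList _).map (h.oppSub_involutive S).injective) fun C => ?_
    rw [List.mem_map_of_involutive (h.oppSub_involutive S), Finset.mem_toList,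
      ← h.oppSub_mem_components_iff hT, h.oppSub_involutive]
  have hconj : ∀ C ∈ (components A T).toList,
      MulAut.conj (setGen A S) (gen C) = gen (oppSub A S C) := fun C hC =>
    mul_inv_eq_of_eq_mul (h.setGen_mul_gen
      ((subset_of_mem_components (Finset.mem_toList.1 hC)).trans hT))
  refine mul_inv_eq_iff_eq_mul.1 ?_
  rw [hT', setGen_eq_prod_toList T, ← MulAut.conj_apply, map_list_prod, List.map_map, List.map_map]
  exact congrArg List.prod (List.map_congr_left hconj)

end IsRootDatum

end Cactus

namespace Folding

variable {X Y : Type*} [Fintype Y] {A : Matrix X X ℤ} {B : Matrix Y Y ℤ} (F : Folding A B)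

theorem orth_image (hB : IsFiniteSymmetric B) (hA : ∀ i, A i i = 2) {I J : Set X}
    (hO : Orth A I J) : Orth B (F.image I) (F.image J) := by
  classical
  intro y hy z hz
  rw [F.mem_image] at hy hz
  have hyz : A (F.proj y) (F.proj z) = 0 := hO _ hy _ hz
  have hsum := (F.cartan_proj y (F.proj z)).symm.trans hyz
  rw [Finset.sum_eq_zero_iff_of_nonpos] at hsum
  · exact hsum z (F.mem_fibre.2 rfl)
  · intro x hx
    refine hB.nonpos y x ?_
    rintro rfl
    rw [F.mem_fibre.1 hx, hA] at hyz
    exact two_ne_zero hyz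

variable [DecidableEq Y]

theorem sTilde_eq_setGen (I : ConnSub A) : F.sTilde I = setGen B (F.image I.1) := rfl

variable [Fintype X] [DecidableEq X]

theorem lift_sTilde_eq_one (hB : IsFiniteSymmetric B) (hA : ∀ i, A i i = 2) :
    ∀ r ∈ {r | CactusRel A r}, FreeGroup.lift F.sTilde r = 1 := by
  have hX := F.isRootDatum hB hA
  have hY := hB.isRootDatum
  rintro _ (I | ⟨I, J, hIJ⟩ | ⟨I, J, K, hJ, hK⟩) <;>
    simp only [map_mul, map_inv, FreeGroup.lift_apply_of, sTilde_eq_setGen, mul_inv_eq_one]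
  · exact setGen_mul_self _
  · exact hY.setGen_comm (F.orth_image hB hA ((hX.not_isConn_union_iff I.2 J.2).1 hIJ))
  · rw [(hX.isThetaImage_iff hJ).1 hK, ← F.opp_image hB hA hJ]
    exact hY.setGen_mul_setGen (F.image_mono hJ)

/-- The homomorphism `Φ : J_X → J_Y` with `Φ(s_I) = s̃_I`. -/
def cactusHom (hB : IsFiniteSymmetric B) (hA : ∀ i, A i i = 2) : CactusGroup A →* CactusGroup B :=
  PresentedGroup.toGroup (F.lift_sTilde_eq_one hB hA)

theorem cactusHom_gen (hB : IsFiniteSymmetric B) (hA : ∀ i, A i i = 2) (I : ConnSub A) :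
    F.cactusHom hB hA (gen I) = F.sTilde I :=
  PresentedGroup.toGroup.of _

end Folding

/-! ### The action on the right-angled Coxeter group -/

section Action

variable {ι : Type*} [Fintype ι] {A : Matrix ι ι ℤ} {d : ι → ℤ} {Φ : Set (ι → ℤ)}

/-- Two sets of vectors are nested or orthogonal. This is the commutation relation between the
letters `w (coordSpan C)` of the right-angled Coxeter group on which the cactus group acts. -/
def NestedOrOrth (A : Matrix ι ι ℤ) (d : ι → ℤ) (P Q : Set (ι → ℤ)) : Prop :=
  P ⊆ Q ∨ Q ⊆ P ∨ ∀ u ∈ P, ∀ v ∈ Q, form A d u v = 0 ∧ form A d v u = 0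

instance : Std.Symm (NestedOrOrth A d) where
  symm _ _
    | .inl h => .inr (.inl h)
    | .inr (.inl h) => .inl h
    | .inr (.inr h) => .inr (.inr fun v hv u hu => (h u hu v hv).symm)

theorem Orth.form_eq_zero {C D : Set ι} (hO : Orth A C D) {u v : ι → ℤ} (hu : u ∈ coordSpan C)
    (hv : v ∈ coordSpan D) : form A d u v = 0 := by
  rw [form_apply]
  refine Finset.sum_eq_zero fun j _ => ?_
  by_cases hj : j ∈ D
  · rw [hO.simpleCoroot_eq_zero hu hj, zero_mul, mul_zero]
  · rw [hv j hj, mul_zero, mul_zero]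

theorem IsSymmetrizable.nestedOrOrth_coordSpan_iff (h : IsSymmetrizable A d) {C D : Set ι} :
    NestedOrOrth A d (coordSpan C) (coordSpan D) ↔ C ⊆ D ∨ D ⊆ C ∨ Orth A C D := by
  classical
  refine or_congr coordSpan_subset_iff (or_congr coordSpan_subset_iff ⟨fun hO i hi j hj => ?_,
    fun hO u hu v hv => ⟨hO.form_eq_zero hu hv, (h.orth_symm hO).form_eq_zero hv hu⟩⟩)
  have hij := (hO _ (simpleRoot_mem_coordSpan.2 hi) _ (simpleRoot_mem_coordSpan.2 hj)).1
  rw [form_simpleRoot_right, simpleCoroot_simpleRoot, mul_eq_zero] at hij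
  exact hij.resolve_left (h.pos j).ne'

variable [DecidableEq ι]

theorem apply_mem_coordSpan_of_mem_parabolic {C D : Set ι} (hO : Orth A C (D \ C))
    {w : Module.End ℤ (ι → ℤ)} (hw : w ∈ parabolic A D) {v : ι → ℤ} (hv : v ∈ coordSpan C) :
    w v ∈ coordSpan C := by
  induction hw using Submonoid.closure_induction_left with
  | one => exact hv
  | mul_left x hx y _ ih =>
    obtain ⟨i, hi, rfl⟩ := hx
    rw [Module.End.mul_apply]
    by_cases hiC : i ∈ C
    · intro k hk
      rw [simpleReflection_apply_of_ne A (ne_of_mem_of_not_mem hiC hk).symm, ih k hk]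
    · rwa [hO.apply_eq_self (simpleReflection_mem_parabolic A ⟨hi, hiC⟩) ih]

theorem exists_word (g : CactusGroup A) : ∃ l : List (ConnSub A), (l.map gen).prod = g := by
  have hg : g ∈ Subgroup.closure (Set.range gen) :=
    (PresentedGroup.closure_range_of {r | CactusRel A r}).ge trivial
  have hinv : (Set.range (gen (A := A)))⁻¹ ⊆ Set.range gen := by
    rintro x ⟨I, hI⟩
    exact ⟨I, by rw [← inv_inv x, ← hI, inv_eq_of_mul_eq_one_right (gen_mul_self I)]⟩
  rw [← Subgroup.mem_toSubmonoid, Subgroup.closure_toSubmonoid, Set.union_eq_left.2 hinv] at hg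
  obtain ⟨l, hl, rfl⟩ := Submonoid.exists_list_of_mem_closure hg
  obtain ⟨l, rfl⟩ : l ∈ Set.range (List.map gen) := by rwa [Set.range_list_map]
  exact ⟨l, rfl⟩

theorem exists_shortest_word (g : CactusGroup A) : ∃ l : List (ConnSub A), (l.map gen).prod = g ∧
    ∀ l' : List (ConnSub A), (l'.map gen).prod = g → l.length ≤ l'.length := by
  obtain ⟨l, hl, hmin⟩ := exists_minimalFor_of_wellFoundedLT
    (fun l : List (ConnSub A) => (l.map gen).prod = g) List.length (exists_word g)
  exact ⟨l, hl, fun l' hl' => (le_total _ _).elim (hmin hl') id⟩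

namespace IsRootDatum

/-- The longest element of `W^I`, as a permutation of the letters. -/
def letterPerm (h : IsRootDatum A d Φ) (I : Set ι) : NestedOrOrth A d ≃r NestedOrOrth A d where
  toEquiv := Equiv.Set.congr ((h.longest_involutive I).toPerm)
  map_rel_iff' {P Q} := by
    have hinj : Function.Injective (longest A I) := (h.longest_involutive I).injective
    simp only [NestedOrOrth, Equiv.Set.congr_apply, Function.Involutive.coe_toPerm,
      Set.image_subset_image_iff hinj, Set.forall_mem_image, h.form_apply_apply (h.longest_mem I)]

theorem letterPerm_apply (h : IsRootDatum A d Φ) (I : Set ι) (P : Set (ι → ℤ)) :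
    h.letterPerm I P = longest A I '' P := rfl

theorem letterPerm_mul_apply (h : IsRootDatum A d Φ) (I J : Set ι) (P : Set (ι → ℤ)) :
    (h.letterPerm I * h.letterPerm J) P = (longest A I * longest A J) '' P := by
  rw [RelIso.mul_apply, letterPerm_apply, letterPerm_apply, Module.End.coe_mul, Set.image_comp]

theorem letterPerm_mul_letterPerm (h : IsRootDatum A d Φ) {I J K L : Set ι}
    (heq : longest A I * longest A J = longest A K * longest A L) :
    h.letterPerm I * h.letterPerm J = h.letterPerm K * h.letterPerm L :=
  RelIso.ext fun P => by rw [letterPerm_mul_apply, letterPerm_mul_apply, heq]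

theorem letterPerm_empty (h : IsRootDatum A d Φ) : h.letterPerm ∅ = 1 :=
  RelIso.ext fun P => by
    rw [letterPerm_apply, ← h.eq_longest NegatesSimple.one]
    exact Set.image_id P

theorem letterPerm_mul_self (h : IsRootDatum A d Φ) (I : Set ι) :
    h.letterPerm I * h.letterPerm I = 1 :=
  RelIso.ext fun P => by
    rw [letterPerm_mul_apply, h.longest_mul_self]
    exact Set.image_id P

theorem letterPerm_union (h : IsRootDatum A d Φ) {C D : Set ι} (hO : Orth A C D) :
    h.letterPerm (C ∪ D) = h.letterPerm C * h.letterPerm D :=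
  RelIso.ext fun P => by rw [letterPerm_mul_apply, letterPerm_apply, h.longest_union hO]

theorem letterPerm_coordSpan (h : IsRootDatum A d Φ) {I J : Set ι} (hJ : J ⊆ I) :
    h.letterPerm I (coordSpan J) = coordSpan (opp A I '' J) :=
  h.image_longest_coordSpan hJ

theorem letterPerm_coordSpan_eq_self (h : IsRootDatum A d Φ) {C D : Set ι}
    (hO : Orth A C (D \ C)) : h.letterPerm D (coordSpan C) = coordSpan C := by
  rw [letterPerm_apply]
  refine Set.Subset.antisymm (Set.image_subset_iff.2 fun v hv => ?_) fun v hv =>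
    ⟨longest A D v, ?_, h.longest_involutive D v⟩
  all_goals exact apply_mem_coordSpan_of_mem_parabolic hO (h.longest_mem D) hv

theorem letterPerm_coordSpan_of_orth (h : IsRootDatum A d Φ) {C D : Set ι} (hO : Orth A C D) :
    h.letterPerm D (coordSpan C) = coordSpan C :=
  h.letterPerm_coordSpan_eq_self fun i hi j hj => hO i hi j hj.1

/-- The action of the generator `s_I` of the cactus group on the right-angled Coxeter group whose
letters are sets of vectors: `w₀^I` acts on the letters, then the letter `coordSpan I` is multiplied
from the left. -/
def genPerm (h : IsRootDatum A d Φ) (I : ConnSub A) : Equiv.Perm (Trace (NestedOrOrth A d)) :=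
  Trace.actPerm (coordSpan I.1) * Trace.mapPerm (NestedOrOrth A d) (h.letterPerm I.1)

theorem genPerm_mul_genPerm (h : IsRootDatum A d Φ) (I J : ConnSub A) :
    h.genPerm I * h.genPerm J =
      Trace.actPerm (coordSpan I.1) * Trace.actPerm (h.letterPerm I.1 (coordSpan J.1)) *
        Trace.mapPerm (NestedOrOrth A d) (h.letterPerm I.1 * h.letterPerm J.1) := by
  rw [genPerm, genPerm, mul_assoc, ← mul_assoc (Trace.mapPerm _ _), Trace.mapPerm_mul_actPerm,
    map_mul]
  simp only [mul_assoc]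

theorem lift_genPerm_eq_one (h : IsRootDatum A d Φ) :
    ∀ r ∈ {r | CactusRel A r}, FreeGroup.lift h.genPerm r = 1 := by
  rintro _ (I | ⟨I, J, hIJ⟩ | ⟨I, J, K, hJ, hK⟩) <;>
    simp only [map_mul, map_inv, FreeGroup.lift_apply_of, mul_inv_eq_one, genPerm_mul_genPerm]
  · rw [← map_mul, h.letterPerm_mul_self, h.letterPerm_coordSpan subset_rfl, h.opp_image_self,
      Trace.actPerm_mul_self, map_one, one_mul]
  · have hO := (h.not_isConn_union_iff I.2 J.2).1 hIJ
    have hcomm : NestedOrOrth A d (coordSpan I.1) (coordSpan J.1) :=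
      h.nestedOrOrth_coordSpan_iff.2 (.inr (.inr hO))
    rw [← map_mul, ← map_mul, h.letterPerm_coordSpan_of_orth hO,
      h.letterPerm_coordSpan_of_orth (h.orth_symm hO),
      h.letterPerm_mul_letterPerm (h.longest_commute hO).eq, (Trace.actPerm_comm hcomm).eq]
  · rw [h.isThetaImage_iff hJ] at hK
    have hKI : K.1 ⊆ I.1 := hK ▸ h.opp_image_subset hJ
    have hcomm : NestedOrOrth A d (coordSpan I.1) (coordSpan K.1) :=
      h.nestedOrOrth_coordSpan_iff.2 (.inr (.inl hKI))
    rw [← map_mul, ← map_mul, h.letterPerm_coordSpan hJ, ← hK,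
      h.letterPerm_coordSpan_eq_self (C := I.1) fun i _ j hj => (hj.2 (hKI hj.1)).elim,
      h.letterPerm_mul_letterPerm (hK ▸ h.longest_mul_longest hJ), (Trace.actPerm_comm hcomm).eq]

/-- The action of the cactus group on the right-angled Coxeter group whose letters are sets of
vectors. -/
def cactusAction (h : IsRootDatum A d Φ) :
    CactusGroup A →* Equiv.Perm (Trace (NestedOrOrth A d)) :=
  PresentedGroup.toGroup h.lift_genPerm_eq_one

theorem cactusAction_gen (h : IsRootDatum A d Φ) (I : ConnSub A) :
    h.cactusAction (gen I) = h.genPerm I :=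
  PresentedGroup.toGroup.of _

theorem cactusAction_prod_gen (h : IsRootDatum A d Φ) (l : List (ConnSub A))
    (hl : l.Pairwise fun C D => Orth A C.1 D.1) :
    h.cactusAction (l.map gen).prod =
      ((l.map fun C => coordSpan C.1).map Trace.actPerm).prod *
        Trace.mapPerm (NestedOrOrth A d) (h.letterPerm {i | ∃ C ∈ l, i ∈ C.1}) := by
  induction l with
  | nil => simp [h.letterPerm_empty]
  | cons C l ih =>
    obtain ⟨hC, hl⟩ := List.pairwise_cons.1 hl
    have hunion : {i | ∃ D ∈ C :: l, i ∈ D.1} = C.1 ∪ {i | ∃ D ∈ l, i ∈ D.1} := by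
      ext i
      simp
    have hO : Orth A C.1 {i | ∃ D ∈ l, i ∈ D.1} := by
      rintro i hi j ⟨D, hD, hj⟩
      exact hC D hD i hi j hj
    have hfix : ((l.map fun D => coordSpan D.1).map (h.letterPerm C.1)) =
        l.map fun D => coordSpan D.1 := by
      rw [List.map_map]
      exact List.map_congr_left fun D hD => h.letterPerm_coordSpan_of_orth (h.orth_symm (hC D hD))
    have hcomm := Trace.mapPerm_mul_prod_actPerm (h.letterPerm C.1) (l.map fun D => coordSpan D.1)
    rw [hfix] at hcomm
    rw [hunion, h.letterPerm_union hO, map_mul (Trace.mapPerm _)]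
    simp only [List.map_cons, List.prod_cons, map_mul, ih hl, cactusAction_gen, genPerm]
    rw [mul_assoc, ← mul_assoc (Trace.mapPerm _ _), hcomm]
    simp only [mul_assoc]

theorem cactusAction_setGen (h : IsRootDatum A d Φ) (S : Set ι) :
    h.cactusAction (setGen A S) =
      (((components A S).toList.map fun C => coordSpan C.1).map Trace.actPerm).prod *
        Trace.mapPerm (NestedOrOrth A d) (h.letterPerm S) := by
  have hS : {i | ∃ C ∈ (components A S).toList, i ∈ C.1} = S := by
    ext i
    simp only [Finset.mem_toList, Set.mem_ofPred_eq]
    exact ⟨fun ⟨C, hC, hi⟩ => subset_of_mem_components hC hi, h.exists_mem_component⟩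
  have horth : (components A S).toList.Pairwise fun C D => Orth A C.1 D.1 :=
    (Finset.nodup_toList _).imp_of_mem fun hC hD hne =>
      h.orth_components (Finset.mem_toList.1 hC) (Finset.mem_toList.1 hD) hne
  rw [setGen_eq_prod_toList, h.cactusAction_prod_gen _ horth, hS]

end IsRootDatum

end Action

/-! ### Injectivity -/

namespace Folding

variable {X Y : Type*} [Fintype Y] {A : Matrix X X ℤ} {B : Matrix Y Y ℤ} (F : Folding A B)

section Components

variable [Finite X] {I K : ConnSub A} {C : ConnSub B}

theorem proj_image_component (hB : IsFiniteSymmetric B) (hA : ∀ i, A i i = 2)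
    (hC : C ∈ components B (F.image I.1)) : F.proj '' C.1 = I.1 := by
  classical
  have := Fintype.ofFinite X
  have hCI : F.proj '' C.1 ⊆ I.1 := Set.image_subset_iff.2 fun y hy =>
    F.mem_image.1 (subset_of_mem_components hC hy)
  refine ((F.isSymmetrizable hB hA).isConn_iff.1 I.2).2 _ hCI (C.nonempty.image _) ?_
  rintro _ ⟨y, hy, rfl⟩ j ⟨hj, hjC⟩
  refine (F.cartan_proj y j).trans (Finset.sum_eq_zero fun z hz => ?_)
  rw [F.mem_fibre] at hz
  exact hB.isSymmetrizable.orth_component hC y hy z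
    ⟨F.mem_image.2 (by rwa [hz]), fun hzC => hjC ⟨z, hzC, hz⟩⟩

theorem subset_of_component_subset (hB : IsFiniteSymmetric B) (hA : ∀ i, A i i = 2)
    {D : ConnSub B} (hC : C ∈ components B (F.image I.1)) (hD : D ∈ components B (F.image K.1))
    (hCD : C.1 ⊆ D.1) : I.1 ⊆ K.1 := by
  rw [← F.proj_image_component hB hA hC, ← F.proj_image_component hB hA hD]
  exact Set.image_mono hCD

theorem orth_of_orth_image (hB : IsFiniteSymmetric B) (hA : ∀ i, A i i = 2)
    (hC : C ∈ components B (F.image I.1)) {J : Set X} (hO : Orth B C.1 (F.image J)) :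
    Orth A I.1 J := by
  classical
  intro i hi j hj
  rw [← F.proj_image_component hB hA hC] at hi
  obtain ⟨y, hy, rfl⟩ := hi
  refine (F.cartan_proj y j).trans (Finset.sum_eq_zero fun z hz => hO y hy z (F.mem_image.2 ?_))
  rwa [F.mem_fibre.1 hz]

theorem nested_or_orth_of_components (hB : IsFiniteSymmetric B) (hA : ∀ i, A i i = 2)
    (hC : C ∈ components B (F.image I.1))
    (hK : ∀ D ∈ components B (F.image K.1), C.1 ⊆ D.1 ∨ D.1 ⊆ C.1 ∨ Orth B C.1 D.1) :
    I.1 ⊆ K.1 ∨ K.1 ⊆ I.1 ∨ Orth A I.1 K.1 := by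
  by_cases hO : Orth B C.1 (F.image K.1)
  · exact .inr (.inr (F.orth_of_orth_image hB hA hC hO))
  · simp only [Orth, not_forall] at hO
    obtain ⟨y, hy, z, hz, hyz⟩ := hO
    obtain ⟨D, hD, hzD⟩ := hB.isSymmetrizable.exists_mem_component hz
    rcases hK D hD with h | h | h
    · exact .inl (F.subset_of_component_subset hB hA hC hD h)
    · exact .inr (.inl (F.subset_of_component_subset hB hA hD hC h))
    · exact (hyz (h y hy z hzD)).elim

end Components

variable [DecidableEq Y]

/-- The word of letters in `Y` which belongs to a word in the generators of `J_X`: the image of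
the empty word under the corresponding product of the `s̃_I`, provided that no letters cancel. -/
def unfold (hB : IsFiniteSymmetric B) : List (ConnSub A) → List (Set (Y → ℤ))
  | [] => []
  | K :: l => ((components B (F.image K.1)).toList.map fun C => coordSpan C.1) ++
      (unfold hB l).map (hB.isRootDatum.letterPerm (F.image K.1))

theorem unfold_eq_nil_iff (hB : IsFiniteSymmetric B) {l : List (ConnSub A)} :
    F.unfold hB l = [] ↔ l = [] := by
  refine ⟨fun hl => ?_, fun hl => hl ▸ rfl⟩
  rcases l with _ | ⟨I, l⟩
  · rfl
  · obtain ⟨i, hi⟩ := I.nonempty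
    obtain ⟨y, rfl⟩ := F.proj_surjective i
    obtain ⟨C, hC, -⟩ := hB.isSymmetrizable.exists_mem_component (F.mem_image.2 hi)
    have hnil := (List.append_eq_nil_iff.1 hl).1
    rw [List.map_eq_nil_iff, Finset.toList_eq_nil] at hnil
    exact (Finset.notMem_empty C (hnil ▸ hC)).elim

theorem cactusAction_setGen_mk (hB : IsFiniteSymmetric B) {I : ConnSub A} {l : List (ConnSub A)}
    (hl : Reduced (NestedOrOrth B 1) (F.unfold hB l))
    (hI : ∀ C ∈ components B (F.image I.1),
      ¬ Cancels (NestedOrOrth B 1) (coordSpan C.1) (F.unfold hB l)) :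
    ∃ h : Reduced (NestedOrOrth B 1) (F.unfold hB (I :: l)),
      hB.isRootDatum.cactusAction (setGen B (F.image I.1)) (Trace.mk (F.unfold hB l) hl) =
        Trace.mk (F.unfold hB (I :: l)) h := by
  have hY := hB.isRootDatum
  have hnodup : ((components B (F.image I.1)).toList.map fun C => coordSpan C.1).Nodup :=
    (Finset.nodup_toList _).map fun _ _ h => Subtype.ext (coordSpan_injective h)
  rw [hY.cactusAction_setGen, Equiv.Perm.mul_apply, Trace.mapPerm_mk]
  refine Trace.prod_actPerm_mk hnodup _ fun P hP hcan => ?_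
  obtain ⟨C, hC, rfl⟩ := List.mem_map.1 hP
  rw [Finset.mem_toList] at hC
  rw [← hY.letterPerm_coordSpan_eq_self (hY.orth_component hC)] at hcan
  exact hI C hC ((cancels_map_iff (RelIso.toRelEmbedding _) _ _).1 hcan)

variable [Fintype X] [DecidableEq X]

theorem exists_gen_mul_gen_eq (hB : IsFiniteSymmetric B) (hA : ∀ i, A i i = 2) {I K : ConnSub A}
    {C : ConnSub B} (hC : C ∈ components B (F.image I.1))
    (hIK : I.1 ⊆ K.1 ∨ K.1 ⊆ I.1 ∨ Orth A I.1 K.1) :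
    ∃ (I' K' : ConnSub A) (C' : ConnSub B), gen I * gen K = gen K' * gen I' ∧
      C' ∈ components B (F.image I'.1) ∧
      hB.isRootDatum.letterPerm (F.image K.1) (coordSpan C'.1) = coordSpan C.1 := by
  have hX := F.isRootDatum hB hA
  have hY := hB.isRootDatum
  rcases hIK with hIK | hKI | hO
  · have hIK' : (oppSub A K.1 I).1 ⊆ K.1 := hX.oppSub_subset_iff.2 hIK
    have hCK : C.1 ⊆ F.image K.1 := (subset_of_mem_components hC).trans (F.image_mono hIK)
    refine ⟨oppSub A K.1 I, K, oppSub B (F.image K.1) C, ?_, ?_, ?_⟩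
    · rw [hX.gen_mul_gen hIK', hX.oppSub_involutive]
    · rw [hX.coe_oppSub hIK, ← F.opp_image hB hA hIK]
      exact hY.oppSub_mem_components_of_mem (F.image_mono hIK) hC
    · rw [hY.coe_oppSub hCK, hY.letterPerm_coordSpan (hY.opp_image_subset hCK),
        hY.opp_image_opp_image hCK]
  · exact ⟨I, oppSub A I.1 K, C, hX.gen_mul_gen hKI, hC, hY.letterPerm_coordSpan_eq_self
      fun y hy z hz => hY.orth_component hC y hy z ⟨F.image_mono hKI hz.1, hz.2⟩⟩
  · exact ⟨I, K, C, hX.commute_gen hO, hC, hY.letterPerm_coordSpan_of_orth fun y hy z hz =>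
      F.orth_image hB hA hO y (subset_of_mem_components hC hy) z hz⟩

theorem exists_shorter_of_cancels (hB : IsFiniteSymmetric B) (hA : ∀ i, A i i = 2)
    (l : List (ConnSub A)) {I : ConnSub A} {C : ConnSub B} (hC : C ∈ components B (F.image I.1))
    (hcan : Cancels (NestedOrOrth B 1) (coordSpan C.1) (F.unfold hB l)) :
    ∃ l' : List (ConnSub A), l'.length + 1 = l.length ∧
      (l'.map gen).prod = gen I * (l.map gen).prod := by
  induction l generalizing I C with
  | nil => exact hcan.elim
  | cons K l ih =>
    rcases hcan.of_append with hmem | ⟨hcomm, hcan⟩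
    · obtain ⟨D, hD, hDC⟩ := List.mem_map.1 hmem
      rw [Finset.mem_toList] at hD
      obtain rfl : I = K := Subtype.ext (by
        rw [← F.proj_image_component hB hA hC, ← F.proj_image_component hB hA hD,
          coordSpan_injective hDC])
      exact ⟨l, rfl, by rw [List.map_cons, List.prod_cons, ← mul_assoc, gen_mul_self, one_mul]⟩
    · have hIK := F.nested_or_orth_of_components hB hA hC fun D hD =>
        hB.isSymmetrizable.nestedOrOrth_coordSpan_iff.1
          (hcomm _ (List.mem_map.2 ⟨D, Finset.mem_toList.2 hD, rfl⟩))
      obtain ⟨I', K', C', hgen, hC', hCC'⟩ := F.exists_gen_mul_gen_eq hB hA hC hIK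
      rw [← hCC'] at hcan
      obtain ⟨l', hlen, hl'⟩ := ih hC' ((cancels_map_iff (RelIso.toRelEmbedding _) _ _).1 hcan)
      refine ⟨K' :: l', by simp [hlen], ?_⟩
      simp only [List.map_cons, List.prod_cons]
      rw [hl', ← mul_assoc, ← mul_assoc, hgen]

theorem cactusAction_cactusHom_of_shortest (hB : IsFiniteSymmetric B) (hA : ∀ i, A i i = 2)
    (l : List (ConnSub A))
    (hmin : ∀ l' : List (ConnSub A), (l'.map gen).prod = (l.map gen).prod → l.length ≤ l'.length) :
    ∃ h : Reduced (NestedOrOrth B 1) (F.unfold hB l),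
      hB.isRootDatum.cactusAction (F.cactusHom hB hA (l.map gen).prod) (Trace.mk [] reduced_nil) =
        Trace.mk (F.unfold hB l) h := by
  induction l with
  | nil => exact ⟨reduced_nil, by simp only [List.map_nil, List.prod_nil, map_one]; rfl⟩
  | cons I l ih =>
    obtain ⟨hl, heq⟩ := ih fun l' hl' => by
      simpa using hmin (I :: l') (by simp [hl'])
    simp only [List.map_cons, List.prod_cons, map_mul, Equiv.Perm.mul_apply, heq, cactusHom_gen,
      sTilde_eq_setGen]
    refine F.cactusAction_setGen_mk hB hl fun C hC hcan => ?_
    obtain ⟨l', hlen, hl'⟩ := F.exists_shorter_of_cancels hB hA l hC hcan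
    have hle := hmin l' (by rw [List.map_cons, List.prod_cons, hl'])
    rw [List.length_cons] at hle
    omega

theorem cactusHom_injective (hB : IsFiniteSymmetric B) (hA : ∀ i, A i i = 2) :
    Function.Injective (F.cactusHom hB hA) := by
  refine (injective_iff_map_eq_one _).2 fun g hg => ?_
  obtain ⟨l, rfl, hmin⟩ := exists_shortest_word g
  obtain ⟨h, heq⟩ := F.cactusAction_cactusHom_of_shortest hB hA l hmin
  rw [hg, map_one, Equiv.Perm.one_apply] at heq
  obtain rfl := (F.unfold_eq_nil_iff hB).1 (Trace.mk_eq_mk_nil.1 heq.symm)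
  rfl

end Folding

/-! ### Virtual cactus groups -/

namespace Folding

variable {X Y : Type*} [Fintype Y] {A : Matrix X X ℤ} {B : Matrix Y Y ℤ} (F : Folding A B)

/-- The generators of the virtual cactus group correspond to those of the cactus group of `X`,
because `σ(I)` determines `I`. -/
def virtualSubEquiv : ConnSub A ≃ F.VirtualSub :=
  Equiv.ofBijective F.virtualSub
    ⟨fun _ _ h => Subtype.ext (F.image_injective (congrArg Subtype.val h)),
      fun ⟨_, I, hI⟩ => ⟨I, Subtype.ext hI⟩⟩

theorem virtualSubEquiv_apply (I : ConnSub A) : F.virtualSubEquiv I = F.virtualSub I := rfl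

variable [Fintype X] [DecidableEq X]

theorem image_cactusRel :
    FreeGroup.freeGroupCongr F.virtualSubEquiv '' {r | CactusRel A r} = {r | VirtualRel F r} := by
  ext r
  constructor
  · rintro ⟨_, I | ⟨I, J, hIJ⟩ | ⟨I, J, K, hJ, hK⟩, rfl⟩ <;>
      simp only [map_mul, map_inv, FreeGroup.freeGroupCongr_apply, FreeGroup.map.of,
        virtualSubEquiv_apply]
    · exact .sq I
    · exact .comm I J hIJ
    · exact .conj I J K hJ hK
  · rintro (I | ⟨I, J, hIJ⟩ | ⟨I, J, K, hJ, hK⟩)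
    · exact ⟨_, .sq I, by simp [virtualSubEquiv_apply]⟩
    · exact ⟨_, .comm I J hIJ, by simp [virtualSubEquiv_apply]⟩
    · exact ⟨_, .conj I J K hJ hK, by simp [virtualSubEquiv_apply]⟩

/-- The isomorphism `J_X ≅ J^v_X` with `s_I ↦ s_{σ(I)}`. -/
def cactusEquivVirtual : CactusGroup A ≃* F.VirtualCactusGroup :=
  (PresentedGroup.equivPresentedGroup _ F.virtualSubEquiv).trans
    (QuotientGroup.quotientMulEquivOfEq (by rw [image_cactusRel]))

theorem cactusEquivVirtual_gen (I : ConnSub A) : F.cactusEquivVirtual (gen I) = F.virtualGen I :=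
  rfl

theorem cactusEquivVirtual_symm_virtualGen (I : ConnSub A) :
    F.cactusEquivVirtual.symm (F.virtualGen I) = gen I :=
  (MulEquiv.symm_apply_eq _).2 (F.cactusEquivVirtual_gen I).symm

end Folding

/-! ### Positive definiteness of the Cartan matrices -/

section PosDef

open Matrix

variable {κ : Type*} [Fintype κ]

theorem two_mul_dotProduct_mulVec_mul {R : Type*} [CommRing R] {B : Matrix κ κ R} (hB : B.IsSymm)
    (x a : κ → R) : 2 * ((x * a) ⬝ᵥ B *ᵥ (x * a)) =
      2 * ((x * a ^ 2) ⬝ᵥ B *ᵥ x) + ∑ i, ∑ j, -(B i j * x i * x j) * (a i - a j) ^ 2 := by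
  have hswap : (x * a ^ 2) ⬝ᵥ B *ᵥ x = ∑ i, ∑ j, B i j * x i * x j * a j ^ 2 := by
    rw [dotProduct_mulVec, ← mulVec_transpose, hB.eq, dotProduct]
    simp only [mulVec, dotProduct, Finset.sum_mul, Pi.mul_apply, Pi.pow_apply]
    exact Finset.sum_congr rfl fun i _ => Finset.sum_congr rfl fun j _ => by ring
  nth_rewrite 2 [two_mul]
  nth_rewrite 2 [hswap]
  simp only [dotProduct, mulVec, Finset.mul_sum, Pi.mul_apply, Pi.pow_apply,
    ← Finset.sum_add_distrib]
  exact Finset.sum_congr rfl fun i _ => Finset.sum_congr rfl fun j _ => by ring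

theorem dotProduct_mulVec_pos_of_mulVec_nonneg {R : Type*} [Field R] [LinearOrder R]
    [IsStrictOrderedRing R] {B : Matrix κ κ R} (hB : B.IsSymm) (hneg : ∀ i j, i ≠ j → B i j ≤ 0)
    {x : κ → R} (hx : ∀ i, 0 < x i) (hBx : ∀ i, 0 ≤ (B *ᵥ x) i) {o : κ} (ho : 0 < (B *ᵥ x) o)
    (hconn : ∀ i, Relation.ReflTransGen (fun i j => B i j ≠ 0) o i) {v : κ → R} (hv : v ≠ 0) :
    0 < v ⬝ᵥ B *ᵥ v := by
  contrapose! hv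
  obtain ⟨a, rfl⟩ : ∃ a, v = x * a :=
    ⟨v / x, funext fun i => (mul_div_cancel₀ (v i) (hx i).ne').symm⟩
  have hS (i : κ) : 0 ≤ (x * a ^ 2) i * (B *ᵥ x) i :=
    mul_nonneg (mul_nonneg (hx i).le (sq_nonneg _)) (hBx i)
  have hT (i j : κ) : 0 ≤ -(B i j * x i * x j) * (a i - a j) ^ 2 := by
    rcases eq_or_ne i j with rfl | hij
    · simp
    · rw [mul_assoc, ← neg_mul]
      exact mul_nonneg (mul_nonneg (neg_nonneg.2 (hneg i j hij))
        (mul_pos (hx i) (hx j)).le) (sq_nonneg _)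
  have hT' (i : κ) := Finset.sum_nonneg fun j (_ : j ∈ Finset.univ) => hT i j
  have hSsum : 0 ≤ (x * a ^ 2) ⬝ᵥ B *ᵥ x := Finset.sum_nonneg fun i _ => hS i
  have hTsum := Finset.sum_nonneg fun i (_ : i ∈ Finset.univ) => hT' i
  have hsum := two_mul_dotProduct_mulVec_mul hB x a
  have hS0 : (x * a ^ 2) o * (B *ᵥ x) o = 0 :=
    (Finset.sum_eq_zero_iff_of_nonneg fun i _ => hS i).1 (by rw [← dotProduct]; linarith) o
      (Finset.mem_univ o)
  have hT0 (i j : κ) : -(B i j * x i * x j) * (a i - a j) ^ 2 = 0 :=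
    (Finset.sum_eq_zero_iff_of_nonneg fun j _ => hT i j).1
      ((Finset.sum_eq_zero_iff_of_nonneg fun i _ => hT' i).1 (by linarith) i (Finset.mem_univ i)) j
      (Finset.mem_univ j)
  have ha (i : κ) : a i = 0 := by
    induction hconn i with
    | refl => simpa [ho.ne', (hx o).ne'] using hS0
    | @tail i j _ hij hi => simpa [hij, (hx i).ne', (hx j).ne', hi] using hT0 i j
  exact funext fun i => by simp [ha i]

theorem form_one_apply (B : Matrix κ κ ℤ) (u v : κ → ℤ) :
    form B 1 u v = u ⬝ᵥ B *ᵥ v := by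
  rw [form_apply, dotProduct_mulVec, dotProduct]
  exact Finset.sum_congr rfl fun j _ => one_mul _

theorem IsFiniteSymmetric.of_mulVec_nonneg {B : Matrix κ κ ℤ} (diag : ∀ i, B i i = 2)
    (symm : B.IsSymm) (nonpos : ∀ i j, i ≠ j → B i j ≤ 0) {x : κ → ℤ} (hx : ∀ i, 0 < x i)
    (hBx : ∀ i, 0 ≤ (B *ᵥ x) i) {o : κ} (ho : 0 < (B *ᵥ x) o)
    (hconn : ∀ i, Relation.ReflTransGen (fun i j => B i j ≠ 0) o i) : IsFiniteSymmetric B where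
  diag := diag
  symm i j := symm.apply j i
  nonpos := nonpos
  pos v hv := by
    let c := Int.castRingHom ℚ
    have hmulVec (u : κ → ℤ) : B.map c *ᵥ (c ∘ u) = c ∘ (B *ᵥ u) :=
      funext fun i => (RingHom.map_mulVec c B u i).symm
    have hpos : 0 < (c ∘ v) ⬝ᵥ B.map c *ᵥ (c ∘ v) := by
      refine dotProduct_mulVec_pos_of_mulVec_nonneg (x := c ∘ x) (o := o) (symm.map _)
        (fun i j hij => Int.cast_nonpos.2 (nonpos i j hij)) (fun i => Int.cast_pos.2 (hx i))
        (fun i => ?_) ?_ (by simpa [c] using hconn)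
        fun h => hv (funext fun i => Int.cast_eq_zero.1 (congrFun h i))
      · rw [hmulVec]
        exact Int.cast_nonneg (hBx i)
      · rw [hmulVec]
        exact Int.cast_pos.2 ho
    rw [hmulVec, ← RingHom.map_dotProduct] at hpos
    rw [form_one_apply]
    exact Int.cast_pos.1 hpos

theorem sum_ite_val_eq {R : Type*} [AddCommMonoid R] (n k : ℕ) (c : R) :
    ∑ j : Fin n, (if (j : ℕ) = k then c else 0) = if k < n then c else 0 := by
  rw [Fin.sum_univ_eq_sum_range (fun j => if j = k then c else 0), Finset.sum_ite_eq']
  simp only [Finset.mem_range]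

theorem reflTransGen_of_val_succ {n : ℕ} {r : Fin n → Fin n → Prop} {i j : Fin n}
    (hr : ∀ a b : Fin n, (a : ℕ) + 1 = b → b ≤ j → r a b) (hij : i ≤ j) :
    Relation.ReflTransGen r i j :=
  reflTransGen_of_succ_of_le r (fun _ hk => hr _ _
    (Nat.covBy_iff_add_one_eq.1 (Order.covBy_succ_of_not_isMax hk.2.not_isMax).coe_fin)
      (Order.succ_le_of_lt hk.2)) hij

theorem mulVec_one_A (n : ℕ) (i : Fin n) : (CartanMatrix.A n *ᵥ 1) i =
    (if (i : ℕ) = 0 then 1 else 0) + if (i : ℕ) + 1 = n then 1 else 0 := by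
  have hrow (j : Fin n) : CartanMatrix.A n i j = (if (j : ℕ) = i then 2 else 0) -
      (if (j : ℕ) = i + 1 then 1 else 0) -
      if (j : ℕ) = i - 1 then (if (i : ℕ) = 0 then 0 else 1) else 0 := by
    simp only [CartanMatrix.A, Matrix.of_apply, Fin.ext_iff]
    split_ifs <;> omega
  have hi := i.isLt
  rw [mulVec, dotProduct]
  simp only [hrow, Pi.one_apply, mul_one, Finset.sum_sub_distrib, sum_ite_val_eq]
  split_ifs <;> omega

theorem isFiniteSymmetric_A {n : ℕ} (hn : 0 < n) : IsFiniteSymmetric (CartanMatrix.A n) := by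
  refine .of_mulVec_nonneg (congrFun (CartanMatrix.A_diag n)) (CartanMatrix.A_isSymm n)
    (CartanMatrix.A_apply_le_zero_of_ne n) (x := 1) (o := ⟨0, hn⟩) (fun _ => one_pos)
    (fun i => ?_) ?_
    fun i => reflTransGen_of_val_succ (fun i j hij _ => ?_) (Fin.mk_le_of_le_val (Nat.zero_le i))
  · rw [mulVec_one_A]
    positivity
  · rw [mulVec_one_A, if_pos rfl]
    positivity
  · rw [CartanMatrix.A, Matrix.of_apply, if_neg (by rintro rfl; omega), if_pos (.inl hij)]
    decide

theorem mulVec_D {n : ℕ} (hn : 2 ≤ n) :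
    CartanMatrix.D (n + 1) *ᵥ (fun j => if (j : ℕ) < n - 1 then 2 else 1) = Pi.single 0 2 := by
  ext i
  have hi := i.isLt
  have hentry (j : Fin (n + 1)) :
      CartanMatrix.D (n + 1) i j * (if (j : ℕ) < n - 1 then 2 else 1) =
        if (i : ℕ) < n - 1 then
          (if (j : ℕ) = i then 4 else 0) - (if (j : ℕ) = i - 1 then (if i = 0 then 0 else 2) else 0)
            - (if (j : ℕ) = i + 1 then (if (i : ℕ) + 1 < n - 1 then 2 else 1) else 0)
            - (if (j : ℕ) = n then (if (i : ℕ) + 2 = n then 1 else 0) else 0)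
        else (if (j : ℕ) = i then 2 else 0) - (if (j : ℕ) = n - 2 then 2 else 0) := by
    have hj := j.isLt
    rcases lt_or_ge (j : ℕ) (n - 1) with hjn | hjn
    · rw [Folding.D_apply_of_lt n i j hjn]
      simp only [Fin.ext_iff, Fin.val_zero]
      split_ifs <;> omega
    · rw [Folding.D_apply_of_le n hn i j hjn]
      simp only [Fin.ext_iff, Fin.val_zero]
      split_ifs <;> omega
  rw [mulVec, dotProduct]
  simp only [hentry, Pi.single_apply, Fin.ext_iff, Fin.val_zero]
  split_ifs <;> simp only [Finset.sum_sub_distrib, sum_ite_val_eq]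
  all_goals split_ifs <;> omega

theorem isFiniteSymmetric_D {n : ℕ} (hn : 2 ≤ n) :
    IsFiniteSymmetric (CartanMatrix.D (n + 1)) := by
  -- `x` is twice the first fundamental weight.
  refine .of_mulVec_nonneg (CartanMatrix.D_diag _) (CartanMatrix.D_isSymm _)
    (CartanMatrix.D_off_diag_nonpos _) (x := fun j => if (j : ℕ) < n - 1 then 2 else 1) (o := 0)
    (fun j => by split_ifs <;> norm_num) (fun i => ?_) ?_ ?_
  · rw [mulVec_D hn]
    exact Pi.single_nonneg (α := fun _ => ℤ).2 zero_le_two i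
  · rw [mulVec_D hn, Pi.single_eq_same]
    exact zero_lt_two
  · have hpath (i : Fin (n + 1)) (hi : (i : ℕ) < n) :
        Relation.ReflTransGen (fun i j => CartanMatrix.D (n + 1) i j ≠ 0) 0 i := by
      refine reflTransGen_of_val_succ (fun a b hab hbi => ?_) (Fin.zero_le i)
      have hbn : (b : ℕ) < n := lt_of_le_of_lt hbi hi
      rcases lt_or_ge (b : ℕ) (n - 1) with hb | hb
      · rw [Folding.D_apply_of_lt n a b hb, if_neg (by omega), if_pos (.inl hab)]
        decide
      · rw [Folding.D_apply_of_le n hn a b hb, if_neg (by omega), if_pos (by omega)]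
        decide
    intro i
    rcases lt_or_ge (i : ℕ) n with hi | hi
    · exact hpath i hi
    · refine (hpath ⟨n - 2, by omega⟩ (Nat.sub_lt (by omega) two_pos)).tail ?_
      rw [Folding.D_apply_of_le n hn _ _ (by omega), if_neg (by simp only; omega),
        if_pos (by simp only; omega)]
      decide

theorem isFiniteSymmetric_E₆ : IsFiniteSymmetric CartanMatrix.E₆ := by
  -- `x` is the highest root.
  refine .of_mulVec_nonneg CartanMatrix.E₆_diag CartanMatrix.E₆_isSymm
    CartanMatrix.E₆_off_diag_nonpos (x := ![1, 2, 2, 3, 2, 1]) (o := 1) (by decide) (by decide)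
    (by decide) fun i => ?_
  have h3 : Relation.ReflTransGen (fun i j => CartanMatrix.E₆ i j ≠ 0) 1 3 :=
    .single (by decide)
  have h2 := h3.tail (c := 2) (by decide)
  have h4 := h3.tail (c := 4) (by decide)
  fin_cases i
  exacts [h2.tail (by decide), .refl, h2, h3, h4, h4.tail (by decide)]

end PosDef

namespace Folding.IsStandard

variable {m k : ℕ} {A : Matrix (Fin m) (Fin m) ℤ} {B : Matrix (Fin k) (Fin k) ℤ} {F : Folding A B}

theorem isFiniteSymmetric (hF : F.IsStandard) : IsFiniteSymmetric B := by
  cases hF with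
  | C n hn => exact isFiniteSymmetric_A (by omega)
  | B n hn => exact isFiniteSymmetric_D hn
  | G => exact isFiniteSymmetric_D (n := 3) (by norm_num)
  | F => exact isFiniteSymmetric_E₆

theorem diag (hF : F.IsStandard) : ∀ i, A i i = 2 := by
  cases hF with
  | C n hn => exact CartanMatrix.C_diag _
  | B n hn => exact CartanMatrix.B_diag _
  | G => exact CartanMatrix.G₂_diag
  | F => exact CartanMatrix.F₄_diag

end Folding.IsStandard

end Dynkin

end

theorem mainTheorem1_general {X Y : Type*} [Fintype X] [DecidableEq X] [Fintype Y] [DecidableEq Y]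
    {A : Matrix X X ℤ} {B : Matrix Y Y ℤ} (F : Dynkin.Folding A B)
    (hB : Dynkin.IsFiniteSymmetric B) (hA : ∀ i, A i i = 2) :
    ∃ Φ : Dynkin.CactusGroup A →* Dynkin.CactusGroup B,
      (∀ I : Dynkin.ConnSub A, Φ (Dynkin.gen I) = F.sTilde I) ∧
      Function.Injective Φ ∧
      (∃ e : F.VirtualCactusGroup ≃* Φ.range,
        ∀ I : Dynkin.ConnSub A, (e (F.virtualGen I) : Dynkin.CactusGroup B) = F.sTilde I) ∧
      (∃ e : F.VirtualCactusGroup ≃* Dynkin.CactusGroup A,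
        ∀ I : Dynkin.ConnSub A, e (F.virtualGen I) = Dynkin.gen I) := by
  refine ⟨F.cactusHom hB hA, F.cactusHom_gen hB hA, F.cactusHom_injective hB hA,
    ⟨F.cactusEquivVirtual.symm.trans (MonoidHom.ofInjective (F.cactusHom_injective hB hA)),
      fun I => ?_⟩, F.cactusEquivVirtual.symm, F.cactusEquivVirtual_symm_virtualGen⟩
  rw [MulEquiv.trans_apply, F.cactusEquivVirtual_symm_virtualGen]
  exact F.cactusHom_gen hB hA I

theorem mainTheorem1 {m k : ℕ} {A : Matrix (Fin m) (Fin m) ℤ} {B : Matrix (Fin k) (Fin k) ℤ}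
    (F : Dynkin.Folding A B) (hF : F.IsStandard) :
    ∃ Φ : Dynkin.CactusGroup A →* Dynkin.CactusGroup B,
      (∀ I : Dynkin.ConnSub A, Φ (Dynkin.gen I) = F.sTilde I) ∧
      Function.Injective Φ ∧
      (∃ e : F.VirtualCactusGroup ≃* Φ.range,
        ∀ I : Dynkin.ConnSub A, (e (F.virtualGen I) : Dynkin.CactusGroup B) = F.sTilde I) ∧
      (∃ e : F.VirtualCactusGroup ≃* Dynkin.CactusGroup A,
        ∀ I : Dynkin.ConnSub A, e (F.virtualGen I) = Dynkin.gen I) := by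
  exact mainTheorem1_general F hF.isFiniteSymmetric hF.diag
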